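/- All Hilbert spaces are complex. $\mathbf{Hilb}$ is the category of Hilbert spaces and bounded linear maps, with the Hilbertian tensor product $\hat\otimes_2$ (the completion of the algebraic tensor product), associator $\alpha$ and symmetry $\sigma$; $f^\dagger$ denotes the Hilbert space adjoint of $f$. A *(commutative) Hilbertian Frobenius semigroup* is a Hilbert space $H$ with a bounded linear map $\mu\colon H\hat\otimes_2 H\to H$ that is associative and commutative and satisfies the Frobenius condition $$(\mu\hat\otimes_2 \mathrm{id})\circ\alpha^{-1}\circ(\mathrm{id}\hat\otimes_2\mu^\dagger)=\mu^\dagger\circ\mu=(\mathrm{id}\hat\otimes_2\mu)\circ\alpha\circ(\mu^\dagger\hat\otimes_2\mathrm{id}).$$ It is *semisimple* if its Jacobson radical, the intersection of all maximal modular ideals of the algebra $(H,\mu)$, is zero (the empty intersection being $H$). A semigroup morphism $f\colon (H,\mu)\to(K,\gamma)$ is a bounded linear map with $f\circ\mu=\gamma\circ(f\hat\otimes_2 f)$; it is *proper* if its range is not contained in any maximal modular ideal of $(K,\gamma)$. Let ${}_c\mathbf{FrobSem}(\mathbb{Hilb})_{\mathsf{proper}}$ be the category of commutative Hilbertian Frobenius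 semigroups and proper semigroup morphisms, and ${}_{\mathsf{semisimple},c}\mathbf{FrobSem}(\mathbb{FdHilb})_{\mathsf{proper}}$ its full subcategory of semisimple finite-dimensional objects. Let ${}_c\mathbf{FrobMon}(\mathbb{FdHilb})$ be the category of finite-dimensional Frobenius monoids $(H,\mu,\eta)$, that is, finite-dimensional commutative Hilbertian Frobenius semigroups $(H,\mu)$ with a unit $\eta\colon\mathbb{C}\to H$, and monoid morphisms (semigroup morphisms $f$ with $f\circ\eta=\eta'$). Let $\mathbf{WSet}$ be the category whose objects are the sets $X$ with a weight function $\alpha\colon X\to[C,+\infty[$ for some $C>0$, and whose morphisms $(X,\alpha)\to(Y,\beta)$ are the maps $f\colon X\to Y$ with finite fibres for which there is $M\ge 0$ with $\sum_{x\in f^{-1}(\{y\})}\alpha(x)\le M\beta(y)$ for all $y\in Y$. Let $\mathbf{FinSet}$ be the category of finite sets and all maps. Then one has the equivalences of categories $${}_c\mathbf{FrobSem}(\mathbb{Hilb})_{\mathsf{proper}}\simeq\mathbf{WSet}^{\mathsf{op}}\times\mathbf{Hilb}$$ and $${}_{\mathsf{semisimple},c}\mathbf{FrobSem}(\mathbb{FdHilb})_{\mathsf{proper}}\simeq{}_c\mathbf{FrobMon}(\mathbb{FdHilb})\simeq\mathbf{FinSet}^{\mathsf{op}}.$$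 -/

import Mathlib

open CategoryTheory
open scoped TensorProduct

universe u

namespace HilbFrob

noncomputable section

/-! ### The Hilbertian tensor product -/

section Tensor

variable {E F G E' F' : Type*}
  [NormedAddCommGroup E] [InnerProductSpace ℂ E]
  [NormedAddCommGroup F] [InnerProductSpace ℂ F]
  [NormedAddCommGroup G] [InnerProductSpace ℂ G]
  [NormedAddCommGroup E'] [InnerProductSpace ℂ E']
  [NormedAddCommGroup F'] [InnerProductSpace ℂ F']

/-- The Hilbertian tensor product of two complex Hilbert spaces: the completion of the algebraic
tensor product for the inner product `⟪a ⊗ b, c ⊗ d⟫ = ⟪a, c⟫ * ⟪b, d⟫`. -/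
abbrev HTensor (E F : Type*) [NormedAddCommGroup E] [InnerProductSpace ℂ E]
    [NormedAddCommGroup F] [InnerProductSpace ℂ F] : Type _ :=
  UniformSpace.Completion (E ⊗[ℂ] F)

namespace HTensor

/-- The inclusion of the algebraic tensor product in the Hilbertian tensor product. -/
def incl (E F : Type*) [NormedAddCommGroup E] [InnerProductSpace ℂ E]
    [NormedAddCommGroup F] [InnerProductSpace ℂ F] : E ⊗[ℂ] F →ₗᵢ[ℂ] HTensor E F :=
  UniformSpace.Completion.toComplₗᵢ

/-- The elementary tensor `x ⊗ y`. -/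
def tmul (x : E) (y : F) : HTensor E F := incl E F (x ⊗ₜ[ℂ] y)

theorem denseRange_incl : DenseRange (incl E F) := UniformSpace.Completion.denseRange_coe

theorem inner_tmul (a c : E) (b d : F) :
    inner ℂ (tmul a b) (tmul c d) = inner ℂ a c * inner ℂ b d := by
  simp [tmul]

/-- The tensor product of two bounded linear maps. -/
def map (f : E →L[ℂ] E') (g : F →L[ℂ] F') : HTensor E F →L[ℂ] HTensor E' F' :=
  (TensorProduct.mapL f g).completion

theorem map_tmul (f : E →L[ℂ] E') (g : F →L[ℂ] F') (x : E) (y : F) :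
    map f g (tmul x y) = tmul (f x) (g y) :=
  UniformSpace.Completion.map_coe (TensorProduct.mapL f g).uniformContinuous (x ⊗ₜ[ℂ] y)

theorem clm_ext {L : Type*} [NormedAddCommGroup L] [NormedSpace ℂ L]
    {f g : HTensor E F →L[ℂ] L} (h : ∀ x y, f (tmul x y) = g (tmul x y)) : f = g := by
  have h' : (f ∘L (incl E F).toContinuousLinearMap).toLinearMap
      = (g ∘L (incl E F).toContinuousLinearMap).toLinearMap :=
    TensorProduct.ext' h
  exact ContinuousLinearMap.coeFn_injective
    (denseRange_incl.equalizer f.continuous g.continuous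
      (funext fun t => LinearMap.congr_fun h' t))

theorem map_id : map (.id ℂ E) (.id ℂ F) = .id ℂ (HTensor E F) :=
  clm_ext fun x y => by simp [map_tmul]

theorem map_comp_map {E'' F'' : Type*}
    [NormedAddCommGroup E''] [InnerProductSpace ℂ E'']
    [NormedAddCommGroup F''] [InnerProductSpace ℂ F'']
    (f' : E' →L[ℂ] E'') (g' : F' →L[ℂ] F'') (f : E →L[ℂ] E') (g : F →L[ℂ] F') :
    map f' g' ∘L map f g = map (f' ∘L f) (g' ∘L g) :=
  clm_ext fun x y => by simp [map_tmul]

theorem continuous_tmul : Continuous fun p : E × F => tmul p.1 p.2 :=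
  (incl E F).continuous.comp TensorProduct.continuous_tmul

theorem dense_of_tmul_mem {S : Submodule ℂ (HTensor E F)} (hS : IsClosed (S : Set (HTensor E F)))
    (h : ∀ x y, tmul x y ∈ S) : S = ⊤ := by
  have h1 : ∀ t : E ⊗[ℂ] F, incl E F t ∈ S := fun t => by
    induction t using TensorProduct.induction_on with
    | zero => simp
    | tmul x y => exact h x y
    | add a b ha hb => rw [map_add]; exact S.add_mem ha hb
  exact eq_top_iff.2 fun t _ =>
    isClosed_property (p := fun t => t ∈ S) denseRange_incl hS h1 t

/-- The isometric embedding of `(E ⊗ F) ⊗ G` (algebraic) in its twofold completion. -/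
def inclLeft (E F G : Type*) [NormedAddCommGroup E] [InnerProductSpace ℂ E]
    [NormedAddCommGroup F] [InnerProductSpace ℂ F] [NormedAddCommGroup G]
    [InnerProductSpace ℂ G] : (E ⊗[ℂ] F) ⊗[ℂ] G →ₗᵢ[ℂ] HTensor (HTensor E F) G :=
  (incl (HTensor E F) G).comp (TensorProduct.mapIsometry (incl E F) .id)

/-- The isometric embedding of `E ⊗ (F ⊗ G)` (algebraic) in its twofold completion. -/
def inclRight (E F G : Type*) [NormedAddCommGroup E] [InnerProductSpace ℂ E]
    [NormedAddCommGroup F] [InnerProductSpace ℂ F] [NormedAddCommGroup G]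
    [InnerProductSpace ℂ G] : E ⊗[ℂ] (F ⊗[ℂ] G) →ₗᵢ[ℂ] HTensor E (HTensor F G) :=
  (incl E (HTensor F G)).comp (TensorProduct.mapIsometry .id (incl F G))

theorem denseRange_inclLeft : DenseRange (inclLeft E F G).toLinearMap := by
  have h := dense_of_tmul_mem (E := HTensor E F) (F := G)
    (S := (LinearMap.range (inclLeft E F G).toLinearMap).topologicalClosure)
    (Submodule.isClosed_topologicalClosure _) fun x y => by
      refine isClosed_property
        (p := fun x => tmul x y ∈ (LinearMap.range (inclLeft E F G).toLinearMap).topologicalClosure)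
        (denseRange_incl (E := E) (F := F)) ?_ ?_ x
      · exact (Submodule.isClosed_topologicalClosure _).preimage
          (continuous_tmul.comp (Continuous.prodMk_left y))
      · exact fun t => Submodule.le_topologicalClosure _ ⟨t ⊗ₜ[ℂ] y, rfl⟩
  intro t
  have ht : t ∈ (LinearMap.range (inclLeft E F G).toLinearMap).topologicalClosure := by
    rw [h]; trivial
  exact ht

theorem denseRange_inclRight : DenseRange (inclRight E F G).toLinearMap := by
  have h := dense_of_tmul_mem (E := E) (F := HTensor F G)
    (S := (LinearMap.range (inclRight E F G).toLinearMap).topologicalClosure)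
    (Submodule.isClosed_topologicalClosure _) fun x y => by
      refine isClosed_property
        (p := fun y => tmul x y ∈
          (LinearMap.range (inclRight E F G).toLinearMap).topologicalClosure)
        (denseRange_incl (E := F) (F := G)) ?_ ?_ y
      · exact (Submodule.isClosed_topologicalClosure _).preimage
          (continuous_tmul.comp (Continuous.prodMk_right x))
      · exact fun t => Submodule.le_topologicalClosure _ ⟨x ⊗ₜ[ℂ] t, rfl⟩
  intro t
  have ht : t ∈ (LinearMap.range (inclRight E F G).toLinearMap).topologicalClosure := by
    rw [h]; trivial
  exact ht

/-- The unitary associator `(x ⊗ y) ⊗ z ↦ x ⊗ (y ⊗ z)`. -/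
def assoc (E F G : Type*) [NormedAddCommGroup E] [InnerProductSpace ℂ E]
    [NormedAddCommGroup F] [InnerProductSpace ℂ F] [NormedAddCommGroup G]
    [InnerProductSpace ℂ G] : HTensor (HTensor E F) G ≃ₗᵢ[ℂ] HTensor E (HTensor F G) :=
  (TensorProduct.assoc ℂ E F G).extendOfIsometry
    (inclLeft E F G).toLinearMap (inclRight E F G).toLinearMap
    denseRange_inclLeft denseRange_inclRight fun x => by
      simp only [LinearIsometry.coe_toLinearMap, LinearIsometry.norm_map, TensorProduct.norm_assoc]

theorem assoc_tmul (x : E) (y : F) (z : G) :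
    assoc E F G (tmul (tmul x y) z) = tmul x (tmul y z) :=
  LinearEquiv.extendOfIsometry_eq (TensorProduct.assoc ℂ E F G)
    (e₁ := (inclLeft E F G).toLinearMap) (e₂ := (inclRight E F G).toLinearMap)
    denseRange_inclLeft denseRange_inclRight
    (fun x => by
      simp only [LinearIsometry.coe_toLinearMap, LinearIsometry.norm_map, TensorProduct.norm_assoc])
    ((x ⊗ₜ[ℂ] y) ⊗ₜ[ℂ] z)

/-- The symmetry `x ⊗ y ↦ y ⊗ x`. -/
def comm (E F : Type*) [NormedAddCommGroup E] [InnerProductSpace ℂ E]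
    [NormedAddCommGroup F] [InnerProductSpace ℂ F] : HTensor E F →L[ℂ] HTensor F E :=
  (TensorProduct.commIsometry ℂ E F).toContinuousLinearEquiv.toContinuousLinearMap.completion

theorem comm_tmul (x : E) (y : F) : comm E F (tmul x y) = tmul y x :=
  UniformSpace.Completion.map_coe
    (TensorProduct.commIsometry ℂ E F).toContinuousLinearEquiv.toContinuousLinearMap.uniformContinuous
    (x ⊗ₜ[ℂ] y)

/-- The left unit constraint `c ⊗ x ↦ c • x`. -/
def lid (E : Type*) [NormedAddCommGroup E] [InnerProductSpace ℂ E] [CompleteSpace E] :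
    HTensor ℂ E →L[ℂ] E :=
  (TensorProduct.lidIsometry ℂ E).toContinuousLinearEquiv.toContinuousLinearMap.extend
    (incl ℂ E).toContinuousLinearMap

theorem lid_tmul [CompleteSpace E] (c : ℂ) (x : E) : lid E (tmul c x) = c • x :=
  ContinuousLinearMap.extend_eq
    (TensorProduct.lidIsometry ℂ E).toContinuousLinearEquiv.toContinuousLinearMap
    (e := (incl ℂ E).toContinuousLinearMap) denseRange_incl
    (incl ℂ E).isometry.isUniformInducing (c ⊗ₜ[ℂ] x)

/-- The right unit constraint `x ⊗ c ↦ c • x`. -/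
def rid (E : Type*) [NormedAddCommGroup E] [InnerProductSpace ℂ E] [CompleteSpace E] :
    HTensor E ℂ →L[ℂ] E :=
  lid E ∘L comm E ℂ

end HTensor

end Tensor

/-! ### Ideals and the Jacobson radical -/

section Ideals

variable {H K L : Type*}
  [NormedAddCommGroup H] [InnerProductSpace ℂ H]
  [NormedAddCommGroup K] [InnerProductSpace ℂ K]
  [NormedAddCommGroup L] [InnerProductSpace ℂ L]

/-- A (two-sided, algebra) ideal of `(H, μ)`. -/
def IsIdeal (μ : HTensor H H →L[ℂ] H) (I : Submodule ℂ H) : Prop :=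
  ∀ a x : H, x ∈ I → μ (.tmul a x) ∈ I ∧ μ (.tmul x a) ∈ I

/-- An ideal `I` is modular when there is a unit modulo `I`. -/
def IsModular (μ : HTensor H H →L[ℂ] H) (I : Submodule ℂ H) : Prop :=
  ∃ u : H, ∀ x : H, μ (.tmul u x) - x ∈ I ∧ μ (.tmul x u) - x ∈ I

/-- A maximal modular ideal: a modular ideal which is maximal among the proper ideals. -/
structure IsMaximalModularIdeal (μ : HTensor H H →L[ℂ] H) (I : Submodule ℂ H) : Prop where
  isIdeal : IsIdeal μ I
  modular : IsModular μ I
  ne_top : I ≠ ⊤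
  maximal : ∀ I' : Submodule ℂ H, IsIdeal μ I' → I ≤ I' → I' ≠ ⊤ → I' = I

/-- The Jacobson radical: the intersection of all maximal modular ideals (all of `H` if there
is none). -/
def jacobsonRadical (μ : HTensor H H →L[ℂ] H) : Submodule ℂ H :=
  sInf {I | IsMaximalModularIdeal μ I}

/-- `f` is multiplicative: `f ∘ μ = γ ∘ (f ⊗ f)`. -/
def IsSemigroupMap (μ : HTensor H H →L[ℂ] H) (γ : HTensor K K →L[ℂ] K) (f : H →L[ℂ] K) : Prop :=
  f ∘L μ = γ ∘L HTensor.map f f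

/-- `f` is proper: its range is not contained in any maximal modular ideal of its codomain. -/
def IsProper (γ : HTensor K K →L[ℂ] K) (f : H →L[ℂ] K) : Prop :=
  ∀ I : Submodule ℂ K, IsMaximalModularIdeal γ I → ¬ LinearMap.range f.toLinearMap ≤ I

/-- Associativity, `μ ∘ (μ ⊗ id) = μ ∘ (id ⊗ μ) ∘ α`, and commutativity, `μ ∘ σ = μ`. -/
structure IsCommSemigroup (μ : HTensor H H →L[ℂ] H) : Prop where
  assoc : μ ∘L HTensor.map μ (.id ℂ H) =
    μ ∘L HTensor.map (.id ℂ H) μ ∘L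
      (HTensor.assoc H H H).toContinuousLinearEquiv.toContinuousLinearMap
  comm : μ ∘L HTensor.comm H H = μ

theorem IsSemigroupMap.apply {μ : HTensor H H →L[ℂ] H} {γ : HTensor K K →L[ℂ] K}
    {f : H →L[ℂ] K} (h : IsSemigroupMap μ γ f) (x y : H) :
    f (μ (.tmul x y)) = γ (.tmul (f x) (f y)) := by
  have := congrArg (fun g => g (HTensor.tmul x y)) h
  simpa [HTensor.map_tmul] using this

theorem IsSemigroupMap.id (μ : HTensor H H →L[ℂ] H) : IsSemigroupMap μ μ (.id ℂ H) := by
  simp [IsSemigroupMap, HTensor.map_id]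

theorem IsSemigroupMap.comp {μ : HTensor H H →L[ℂ] H} {γ : HTensor K K →L[ℂ] K}
    {ρ : HTensor L L →L[ℂ] L} {g : K →L[ℂ] L} {f : H →L[ℂ] K}
    (hg : IsSemigroupMap γ ρ g) (hf : IsSemigroupMap μ γ f) : IsSemigroupMap μ ρ (g ∘L f) :=
  HTensor.clm_ext fun x y => by simp [hf.apply, hg.apply, HTensor.map_tmul]

theorem IsCommSemigroup.mul_comm {μ : HTensor H H →L[ℂ] H} (h : IsCommSemigroup μ) (x y : H) :
    μ (.tmul x y) = μ (.tmul y x) := by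
  have := congrArg (fun g => g (HTensor.tmul y x)) h.comm
  simpa [HTensor.comm_tmul] using this

theorem IsCommSemigroup.mul_assoc {μ : HTensor H H →L[ℂ] H} (h : IsCommSemigroup μ) (x y z : H) :
    μ (.tmul (μ (.tmul x y)) z) = μ (.tmul x (μ (.tmul y z))) := by
  have := congrArg (fun g => g (HTensor.tmul (HTensor.tmul x y) z)) h.assoc
  simpa [HTensor.map_tmul, HTensor.assoc_tmul] using this

theorem IsProper.id (μ : HTensor H H →L[ℂ] H) : IsProper μ (.id ℂ H) := fun _ hI h =>
  hI.ne_top (eq_top_iff.2 fun x _ => h ⟨x, rfl⟩)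

/-- The underlying bounded bilinear map. -/
def bil (μ : HTensor H H →L[ℂ] H) : H →L[ℂ] H →L[ℂ] H :=
  (ContinuousLinearMap.compL ℂ H (H ⊗[ℂ] H) H (μ ∘L (HTensor.incl H H).toContinuousLinearMap)) ∘L
    TensorProduct.mkL ℂ H H

theorem bil_apply (μ : HTensor H H →L[ℂ] H) (x y : H) : bil μ x y = μ (.tmul x y) := rfl

theorem IsMaximalModularIdeal.isClosed [CompleteSpace H] {μ : HTensor H H →L[ℂ] H}
    {I : Submodule ℂ H} (hI : IsMaximalModularIdeal μ I) : IsClosed (I : Set H) := by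
  by_cases htop : I.topologicalClosure = ⊤
  · exfalso
    obtain ⟨u, hu⟩ := hI.modular
    have hmem : u ∈ closure (I : Set H) := by
      rw [← Submodule.topologicalClosure_coe, htop]; trivial
    have hcont : Continuous fun m => ‖bil μ (u - m)‖ := by fun_prop
    have hopen : IsOpen {m | ‖bil μ (u - m)‖ < 1} := isOpen_lt hcont continuous_const
    obtain ⟨m, hm1, hm2⟩ := mem_closure_iff.1 hmem _ hopen (by simp)
    obtain ⟨V, hV⟩ := (isUnit_one_sub_of_norm_lt_one hm1).exists_right_inv
    refine hI.ne_top (eq_top_iff.2 fun z _ => ?_)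
    have hz : V z - (bil μ u (V z) - bil μ m (V z)) = z := by
      simpa using congrArg (fun g => g z) hV
    have h1 : bil μ u (V z) - V z ∈ I := (hu (V z)).1
    have h2 : bil μ m (V z) ∈ I := (hI.isIdeal (V z) m hm2).2
    rw [← hz]
    have : V z - (bil μ u (V z) - bil μ m (V z)) =
        bil μ m (V z) - (bil μ u (V z) - V z) := by abel
    rw [this]
    exact I.sub_mem h2 h1
  · have hid : IsIdeal μ I.topologicalClosure := by
      intro a x hx
      constructor
      · exact map_mem_closure (f := fun x => bil μ a x) (by fun_prop) hx
          fun y hy => (hI.isIdeal a y hy).1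
      · exact map_mem_closure (f := fun x => bil μ x a) (by fun_prop) hx
          fun y hy => (hI.isIdeal a y hy).2
    rw [← hI.maximal _ hid I.le_topologicalClosure htop]
    exact I.isClosed_topologicalClosure

/-- A maximal modular ideal of a commutative Hilbertian algebra is the kernel of a nonzero
character (Gelfand--Mazur). -/
theorem IsMaximalModularIdeal.exists_character [CompleteSpace H] {μ : HTensor H H →L[ℂ] H}
    (hμ : IsCommSemigroup μ) {I : Submodule ℂ H} (hI : IsMaximalModularIdeal μ I) :
    ∃ χ : H →ₗ[ℂ] ℂ, (∀ x y, χ (μ (.tmul x y)) = χ x * χ y) ∧ LinearMap.ker χ = I := by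
  obtain ⟨u, hu⟩ := hI.modular
  have hu1 : ∀ x, bil μ u x - x ∈ I := fun x => (hu x).1
  have hl : ∀ a x, x ∈ I → bil μ a x ∈ I := fun a x hx => (hI.isIdeal a x hx).1
  have hr : ∀ a x, x ∈ I → bil μ x a ∈ I := fun a x hx => (hI.isIdeal a x hx).2
  have hassoc : ∀ x y z, bil μ (bil μ x y) z = bil μ x (bil μ y z) := hμ.mul_assoc
  have hcomm : ∀ x y, bil μ x y = bil μ y x := hμ.mul_comm
  have huI : u ∉ I := fun h => hI.ne_top (eq_top_iff.2 fun x _ => by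
    simpa using I.sub_mem (hr x u h) (hu1 x))
  have hcl := hI.isClosed
  let T : H → ((H ⧸ I) →L[ℂ] (H ⧸ I)) := fun x =>
    { toLinearMap := I.mapQ I (bil μ x).toLinearMap fun y hy => hl x y hy
      cont := by
        refine I.isOpenQuotientMap_mkQ.isQuotientMap.continuous_iff.2 ?_
        exact I.isOpenQuotientMap_mkQ.continuous.comp (bil μ x).continuous }
  have hT : ∀ x y, T x (I.mkQ y) = I.mkQ (bil μ x y) := fun x y => rfl
  have hText : ∀ {f g : (H ⧸ I) →L[ℂ] (H ⧸ I)}, (∀ y, f (I.mkQ y) = g (I.mkQ y)) → f = g := by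
    intro f g h
    ext q
    obtain ⟨y, rfl⟩ := I.mkQ_surjective q
    exact h y
  have hmk : ∀ {x y : H}, x - y ∈ I → I.mkQ x = I.mkQ y := fun h =>
    (Submodule.Quotient.eq I).2 h
  have : Nontrivial (H ⧸ I) := Submodule.Quotient.nontrivial_iff.2 hI.ne_top
  have key : ∀ x, ∃ c : ℂ, x - c • u ∈ I := by
    intro x
    obtain ⟨c, hc⟩ := spectrum.nonempty (T x)
    refine ⟨c, ?_⟩
    by_contra hw
    have hTw : T (x - c • u) = T x - algebraMap ℂ _ c := by
      refine hText fun y => ?_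
      have : T u (I.mkQ y) = I.mkQ y := hmk (hu1 y)
      simp only [hT, map_sub, map_smul, sub_apply,
        smul_apply, Algebra.algebraMap_eq_smul_one,
        one_apply_eq_self] at this ⊢
      rw [this]
    set w := x - c • u with hwdef
    let I' : Submodule ℂ H := LinearMap.range (bil μ w).toLinearMap ⊔ I
    have hwI' : w ∈ I' := by
      refine Submodule.mem_sup.2 ⟨bil μ w u, ⟨u, rfl⟩, -(bil μ u w - w), I.neg_mem (hu1 w), ?_⟩
      rw [hcomm w u]; abel
    have hid' : ∀ a z, z ∈ I' → bil μ a z ∈ I' := by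
      intro a z hz
      obtain ⟨_, ⟨b, rfl⟩, m, hm, rfl⟩ := Submodule.mem_sup.1 hz
      refine Submodule.mem_sup.2 ⟨bil μ w (bil μ a b), ⟨_, rfl⟩, bil μ a m, hl a m hm, ?_⟩
      rw [map_add]
      congr 1
      change _ = bil μ a (bil μ w b)
      rw [← hassoc, hcomm w a, hassoc]
    have htop : I' = ⊤ := by
      by_contra hne
      refine hw ?_
      rw [← hI.maximal I' (fun a z hz => ⟨hid' a z hz, ?_⟩) le_sup_right hne]
      · exact hwI'
      · have h := hid' a z hz
        rw [hcomm] at h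
        exact h
    have humem : u ∈ I' := by rw [htop]; trivial
    obtain ⟨_, ⟨b, rfl⟩, m, hm, hsum⟩ := Submodule.mem_sup.1 humem
    have h1 : T w * T b = 1 := by
      refine hText fun y => ?_
      change I.mkQ (bil μ w (bil μ b y)) = I.mkQ y
      refine hmk ?_
      have : bil μ w (bil μ b y) - y = (bil μ u y - y) - bil μ m y := by
        rw [← hsum, ← hassoc]
        simp only [map_add, add_apply, ContinuousLinearMap.coe_coe]
        abel
      rw [this]
      exact I.sub_mem (hu1 y) (hr y m hm)
    have h2 : T b * T w = T w * T b := by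
      refine hText fun y => ?_
      change I.mkQ (bil μ b (bil μ w y)) = I.mkQ (bil μ w (bil μ b y))
      rw [← hassoc, hcomm b w, hassoc]
    have hunit : IsUnit (T w) := ⟨⟨T w, T b, h1, h2.trans h1⟩, rfl⟩
    rw [hTw] at hunit
    apply spectrum.mem_iff.1 hc
    rw [← neg_sub]
    exact hunit.neg
  obtain ⟨f, hfu, hfI⟩ := Submodule.exists_le_ker_of_notMem huI
  have hfI' : ∀ x ∈ I, f x = 0 := fun x hx => hfI hx
  have hχ : ∀ x (c : ℂ), x - c • u ∈ I → f x = c * f u := by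
    intro x c h
    have := hfI' _ h
    rw [map_sub, map_smul, smul_eq_mul, sub_eq_zero] at this
    exact this
  refine ⟨(f u)⁻¹ • f, ?_, ?_⟩
  · intro x y
    obtain ⟨c, hc⟩ := key x
    have h1 : bil μ x y - c • y ∈ I := by
      have h2 : bil μ x y - c • y = bil μ (x - c • u) y + c • (bil μ u y - y) := by
        simp only [map_sub, map_smul, sub_apply,
          smul_apply, smul_sub]
        abel
      rw [h2]
      exact I.add_mem (hr y _ hc) (I.smul_mem c (hu1 y))
    have h3 : f (bil μ x y) = c * f y := by
      have := hfI' _ h1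
      rw [map_sub, map_smul, smul_eq_mul, sub_eq_zero] at this
      exact this
    rw [bil_apply] at h3
    simp only [LinearMap.smul_apply, smul_eq_mul, h3, hχ x c hc]
    field_simp
  · refine le_antisymm (fun x hx => ?_) (fun x hx => ?_)
    · obtain ⟨c, hc⟩ := key x
      have hx0 : (f u)⁻¹ * f x = 0 := hx
      rw [hχ x c hc] at hx0
      have : c = 0 := by simpa [hfu] using hx0
      simpa [this] using hc
    · simp [hfI' x hx]

/-- The kernel of a nonzero character is a maximal modular ideal. -/
theorem isMaximalModularIdeal_ker {μ : HTensor H H →L[ℂ] H} {χ : H →ₗ[ℂ] ℂ}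
    (hχ : ∀ x y, χ (μ (.tmul x y)) = χ x * χ y) (h0 : χ ≠ 0) :
    IsMaximalModularIdeal μ (LinearMap.ker χ) := by
  obtain ⟨v, hv⟩ : ∃ v, χ v ≠ 0 := by
    by_contra! h
    exact h0 (LinearMap.ext h)
  have hu : χ ((χ v)⁻¹ • v) = 1 := by simp [hv]
  refine ⟨fun a x hx => ?_, ⟨(χ v)⁻¹ • v, fun x => ?_⟩, ?_, ?_⟩
  · have hx' : χ x = 0 := hx
    simp [LinearMap.mem_ker, hχ, hx']
  · simp only [LinearMap.mem_ker, map_sub, hχ, hu]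
    simp
  · intro h
    exact hv (LinearMap.mem_ker.1 (h ▸ Submodule.mem_top))
  · intro I' _ hle hne
    refine le_antisymm (fun x hx => ?_) hle
    by_contra hxk
    have hxk' : χ x ≠ 0 := hxk
    refine hne (eq_top_iff.2 fun y _ => ?_)
    have h1 : y - (χ y / χ x) • x ∈ I' := hle (by
      simp [LinearMap.mem_ker, hxk'])
    simpa using I'.add_mem h1 (I'.smul_mem (χ y / χ x) hx)

theorem IsProper.comp [CompleteSpace L] {γ : HTensor K K →L[ℂ] K}
    {ρ : HTensor L L →L[ℂ] L} (hρ : IsCommSemigroup ρ)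
    {g : K →L[ℂ] L} {f : H →L[ℂ] K}
    (hgm : IsSemigroupMap γ ρ g) (hg : IsProper ρ g) (hf : IsProper γ f) :
    IsProper ρ (g ∘L f) := by
  intro I hI hle
  obtain ⟨χ, hχ, rfl⟩ := hI.exists_character hρ
  have hker := isMaximalModularIdeal_ker (μ := γ) (χ := χ ∘ₗ g.toLinearMap)
    (fun x y => by simp [hgm.apply, hχ]) (fun h0 => hg _ hI (by
      rintro _ ⟨x, rfl⟩
      exact LinearMap.congr_fun h0 x))
  refine hf _ hker ?_
  rintro _ ⟨x, rfl⟩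
  exact hle ⟨x, rfl⟩

/-- The `†`-Frobenius condition: both cells of the Frobenius diagram commute, that is
`(μ ⊗ id) ∘ α⁻¹ ∘ (id ⊗ μ†) = μ† ∘ μ` and `(id ⊗ μ) ∘ α ∘ (μ† ⊗ id) = μ† ∘ μ`, where `μ†` is the
Hilbert space adjoint of `μ`. -/
structure IsFrobenius [CompleteSpace H] (μ : HTensor H H →L[ℂ] H) : Prop where
  upper : HTensor.map μ (.id ℂ H) ∘L
      (HTensor.assoc H H H).symm.toContinuousLinearEquiv.toContinuousLinearMap ∘L
      HTensor.map (.id ℂ H) (ContinuousLinearMap.adjoint μ) =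
    ContinuousLinearMap.adjoint μ ∘L μ
  lower : HTensor.map (.id ℂ H) μ ∘L
      (HTensor.assoc H H H).toContinuousLinearEquiv.toContinuousLinearMap ∘L
      HTensor.map (ContinuousLinearMap.adjoint μ) (.id ℂ H) =
    ContinuousLinearMap.adjoint μ ∘L μ

end Ideals

/-! ### The categories -/

/-- Complex Hilbert spaces. -/
structure Hilb : Type (u + 1) where
  carrier : Type u
  [normedAddCommGroup : NormedAddCommGroup carrier]
  [innerProductSpace : InnerProductSpace ℂ carrier]
  [completeSpace : CompleteSpace carrier]

namespace Hilb

instance : CoeSort Hilb.{u} (Type u) := ⟨Hilb.carrier⟩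

instance (H : Hilb.{u}) : NormedAddCommGroup H := H.normedAddCommGroup

instance (H : Hilb.{u}) : InnerProductSpace ℂ H := H.innerProductSpace

instance (H : Hilb.{u}) : CompleteSpace H := H.completeSpace

/-- The category of complex Hilbert spaces and bounded linear maps. -/
instance : Category Hilb.{u} where
  Hom H K := H →L[ℂ] K
  id H := .id ℂ H
  comp f g := g ∘L f

end Hilb

/-- Commutative Hilbertian Frobenius semigroups. -/
structure FrobSem : Type (u + 1) extends Hilb.{u} where
  mul : HTensor toHilb toHilb →L[ℂ] toHilb
  isCommSemigroup : IsCommSemigroup mul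
  isFrobenius : IsFrobenius mul

/-- A commutative Hilbertian Frobenius semigroup is semisimple when its Jacobson radical is zero. -/
def FrobSem.IsSemisimple (A : FrobSem.{u}) : Prop := jacobsonRadical A.mul = ⊥

/-- Proper semigroup morphisms. -/
@[ext]
structure FrobSem.ProperHom (A B : FrobSem.{u}) : Type u where
  toCLM : A.toHilb →L[ℂ] B.toHilb
  isSemigroupMap : IsSemigroupMap A.mul B.mul toCLM
  isProper : IsProper B.mul toCLM

/-- The category of commutative Hilbertian Frobenius semigroups and proper semigroup morphisms. -/
instance FrobSem.properCategory : Category FrobSem.{u} where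
  Hom A B := FrobSem.ProperHom A B
  id A := ⟨.id ℂ A.toHilb, IsSemigroupMap.id A.mul, IsProper.id A.mul⟩
  comp {_ _ C} f g := ⟨g.toCLM ∘L f.toCLM, g.isSemigroupMap.comp f.isSemigroupMap,
    IsProper.comp C.isCommSemigroup g.isSemigroupMap g.isProper f.isProper⟩

/-- Finite-dimensional semisimple commutative Hilbertian Frobenius semigroups. -/
def isSemisimpleFd : ObjectProperty FrobSem.{u} :=
  fun A => A.IsSemisimple ∧ FiniteDimensional ℂ A.toHilb

/-- The category of finite-dimensional semisimple commutative Hilbertian Frobenius semigroups and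
proper semigroup morphisms. -/
abbrev SemisimpleFdFrobSem : Type (u + 1) := isSemisimpleFd.{u}.FullSubcategory

/-- Finite-dimensional commutative Hilbertian Frobenius monoids `(H, μ, η)`. -/
structure FdFrobMon : Type (u + 1) extends FrobSem.{u} where
  unit : ℂ →L[ℂ] toHilb
  finiteDimensional : FiniteDimensional ℂ toHilb
  unit_mul : mul ∘L HTensor.map unit (.id ℂ toHilb) = HTensor.lid toHilb
  mul_unit : mul ∘L HTensor.map (.id ℂ toHilb) unit = HTensor.rid toHilb

/-- Morphisms of monoids. -/
@[ext]
structure FdFrobMon.Hom (A B : FdFrobMon.{u}) : Type u where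
  toCLM : A.toHilb →L[ℂ] B.toHilb
  isSemigroupMap : IsSemigroupMap A.mul B.mul toCLM
  map_unit : toCLM ∘L A.unit = B.unit

/-- The category of finite-dimensional commutative Hilbertian Frobenius monoids. -/
instance : Category FdFrobMon.{u} where
  Hom A B := FdFrobMon.Hom A B
  id A := ⟨.id ℂ A.toHilb, IsSemigroupMap.id A.mul, ContinuousLinearMap.id_comp _⟩
  comp f g := ⟨g.toCLM ∘L f.toCLM, g.isSemigroupMap.comp f.isSemigroupMap, by
    rw [ContinuousLinearMap.comp_assoc, f.map_unit, g.map_unit]⟩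

/-- Weighted sets: sets `X` with a weight function `X → [C, +∞[` for some `C > 0`. -/
structure WSet : Type (u + 1) where
  carrier : Type u
  weight : carrier → ℝ
  weight_bound : ∃ C : ℝ, 0 < C ∧ ∀ x, C ≤ weight x

/-- Maps `f` with finite fibres for which there is `M ≥ 0` such that the total weight of the fibre
of each `y` is at most `M` times the weight of `y`. -/
@[ext]
structure WSet.Hom (X Y : WSet.{u}) : Type u where
  toFun : X.carrier → Y.carrier
  finite_fiber : ∀ y, (toFun ⁻¹' {y}).Finite
  weight_le : ∃ M : ℝ, 0 ≤ M ∧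
    ∀ y, ∑ x ∈ (finite_fiber y).toFinset, X.weight x ≤ M * Y.weight y

/-- The identity map of a weighted set. -/
def WSet.Hom.id (X : WSet.{u}) : WSet.Hom X X where
  toFun x := x
  finite_fiber y := Set.finite_singleton y
  weight_le := ⟨1, zero_le_one, fun y => by
    have h' : ∀ hf : ((fun x => x) ⁻¹' {y} : Set X.carrier).Finite, hf.toFinset = {y} := by
      intro hf; ext; simp
    rw [h']; simp⟩

/-- Composition of morphisms of weighted sets. -/
def WSet.Hom.comp {X Y Z : WSet.{u}} (f : WSet.Hom X Y) (g : WSet.Hom Y Z) : WSet.Hom X Z where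
  toFun x := g.toFun (f.toFun x)
  finite_fiber z := by
    have h := (g.finite_fiber z).biUnion fun y _ => f.finite_fiber y
    refine h.subset fun x hx => ?_
    exact Set.mem_biUnion (x := f.toFun x) hx rfl
  weight_le := by
    classical
    obtain ⟨M, hM, hf⟩ := f.weight_le
    obtain ⟨N, hN, hg⟩ := g.weight_le
    refine ⟨M * N, mul_nonneg hM hN, fun z => ?_⟩
    have hfib : ∀ h : ((fun x => g.toFun (f.toFun x)) ⁻¹' {z}).Finite,
        h.toFinset = (g.finite_fiber z).toFinset.biUnion fun y => (f.finite_fiber y).toFinset := by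
      intro h; ext x; simp
    rw [hfib, Finset.sum_biUnion]
    · calc ∑ y ∈ (g.finite_fiber z).toFinset, ∑ x ∈ (f.finite_fiber y).toFinset, X.weight x
          ≤ ∑ y ∈ (g.finite_fiber z).toFinset, M * Y.weight y :=
            Finset.sum_le_sum fun y _ => hf y
        _ = M * ∑ y ∈ (g.finite_fiber z).toFinset, Y.weight y := (Finset.mul_sum ..).symm
        _ ≤ M * (N * Z.weight z) := mul_le_mul_of_nonneg_left (hg z) hM
        _ = M * N * Z.weight z := (mul_assoc ..).symm
    · intro y _ y' _ hne
      refine Finset.disjoint_left.2 fun x hx hx' => hne ?_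
      simp only [Set.Finite.mem_toFinset, Set.mem_preimage, Set.mem_singleton_iff] at hx hx'
      rw [← hx, ← hx']

/-- The category of weighted sets. -/
instance : Category WSet.{u} where
  Hom X Y := WSet.Hom X Y
  id X := WSet.Hom.id X
  comp f g := WSet.Hom.comp f g

end

end HilbFrob

namespace HilbFrob

noncomputable section

open ContinuousLinearMap (adjoint)
open WithLp (toLp)
open Opposite (op)

/-! ### The Frobenius condition and module maps -/

namespace HTensor

variable {E F G E' F' : Type*}
  [NormedAddCommGroup E] [InnerProductSpace ℂ E]
  [NormedAddCommGroup F] [InnerProductSpace ℂ F]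
  [NormedAddCommGroup G] [InnerProductSpace ℂ G]
  [NormedAddCommGroup E'] [InnerProductSpace ℂ E']
  [NormedAddCommGroup F'] [InnerProductSpace ℂ F']

/-- The bounded bilinear map `(x, y) ↦ x ⊗ y`. -/
def tmulL (E F : Type*) [NormedAddCommGroup E] [InnerProductSpace ℂ E]
    [NormedAddCommGroup F] [InnerProductSpace ℂ F] : E →L[ℂ] F →L[ℂ] HTensor E F :=
  (ContinuousLinearMap.compL ℂ F (E ⊗[ℂ] F) (HTensor E F)
    (incl E F).toContinuousLinearMap) ∘L TensorProduct.mkL ℂ E F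

theorem tmulL_apply (x : E) (y : F) : tmulL E F x y = tmul x y := rfl

theorem norm_tmul (x : E) (y : F) : ‖tmul x y‖ = ‖x‖ * ‖y‖ := by
  simp [tmul]

theorem ext_inner_tmul {s t : HTensor E F}
    (h : ∀ x y, inner ℂ (tmul x y) s = inner ℂ (tmul x y) t) : s = t := by
  have : innerSL ℂ s = innerSL ℂ t := clm_ext fun x y => by
    simpa using congrArg (starRingEnd ℂ) (h x y)
  exact (InnerProductSpace.toDualMap ℂ (HTensor E F)).injective this

theorem clm_ext₃ {L : Type*} [NormedAddCommGroup L] [NormedSpace ℂ L]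
    {f g : HTensor (HTensor E F) G →L[ℂ] L}
    (h : ∀ x y z, f (tmul (tmul x y) z) = g (tmul (tmul x y) z)) : f = g :=
  clm_ext fun t z => by
    have : f ∘L (tmulL (HTensor E F) G).flip z = g ∘L (tmulL (HTensor E F) G).flip z :=
      clm_ext fun x y => h x y z
    exact congrArg (fun k => k t) this

theorem inner_tmul_map [CompleteSpace E] [CompleteSpace F] [CompleteSpace E'] [CompleteSpace F']
    (f : E →L[ℂ] E') (g : F →L[ℂ] F') (x : E') (y : F') (t : HTensor E F) :
    inner ℂ (tmul x y) (map f g t) = inner ℂ (tmul (adjoint f x) (adjoint g y)) t := by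
  have : innerSL ℂ (tmul x y) ∘L map f g = innerSL ℂ (tmul (adjoint f x) (adjoint g y)) :=
    clm_ext fun a b => by
      simp [map_tmul, inner_tmul, ContinuousLinearMap.adjoint_inner_left]
  exact congrArg (fun h => h t) this

end HTensor

section Frobenius

variable {H : Type*} [NormedAddCommGroup H] [InnerProductSpace ℂ H]

theorem map_mul_assoc_symm_tmulL (μ : HTensor H H →L[ℂ] H) (a : H) :
    HTensor.map μ (.id ℂ H) ∘L
      (HTensor.assoc H H H).symm.toContinuousLinearEquiv.toContinuousLinearMap ∘L
      HTensor.tmulL H (HTensor H H) a = HTensor.map (bil μ a) (.id ℂ H) :=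
  HTensor.clm_ext fun x y => by
    have h : (HTensor.assoc H H H).symm (.tmul a (.tmul x y)) = .tmul (.tmul a x) y := by
      rw [LinearIsometryEquiv.symm_apply_eq, HTensor.assoc_tmul]
    simp [HTensor.tmulL_apply, h, HTensor.map_tmul, bil_apply]

theorem map_mul_assoc_tmulL (μ : HTensor H H →L[ℂ] H) (b : H) :
    HTensor.map (.id ℂ H) μ ∘L
      (HTensor.assoc H H H).toContinuousLinearEquiv.toContinuousLinearMap ∘L
      (HTensor.tmulL (HTensor H H) H).flip b = HTensor.map (.id ℂ H) ((bil μ).flip b) :=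
  HTensor.clm_ext fun x y => by
    simp [HTensor.tmulL_apply, HTensor.assoc_tmul, HTensor.map_tmul, bil_apply]

variable [CompleteSpace H] {μ : HTensor H H →L[ℂ] H}

theorem inner_tmul_adjoint (μ : HTensor H H →L[ℂ] H) (c d x : H) :
    inner ℂ (HTensor.tmul c d) (adjoint μ x) = inner ℂ (bil μ c d) x := by
  rw [ContinuousLinearMap.adjoint_inner_right, bil_apply]

theorem map_bil_adjoint_iff (μ : HTensor H H →L[ℂ] H) :
    (∀ a b, HTensor.map (bil μ a) (.id ℂ H) (adjoint μ b) = adjoint μ (bil μ a b)) ↔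
      ∀ a c d, adjoint (bil μ a) (bil μ c d) = bil μ (adjoint (bil μ a) c) d := by
  have key : ∀ a b c d : H,
      inner ℂ (HTensor.tmul c d) (HTensor.map (bil μ a) (.id ℂ H) (adjoint μ b)) =
        inner ℂ (bil μ (adjoint (bil μ a) c) d) b ∧
      inner ℂ (HTensor.tmul c d) (adjoint μ (bil μ a b)) =
        inner ℂ (adjoint (bil μ a) (bil μ c d)) b := fun a b c d => by
    constructor
    · rw [HTensor.inner_tmul_map, inner_tmul_adjoint, ContinuousLinearMap.adjoint_id]
      rfl
    · rw [inner_tmul_adjoint, ContinuousLinearMap.adjoint_inner_left]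
  constructor
  · intro h a c d
    refine ext_inner_right ℂ fun b => ?_
    rw [← (key a b c d).1, ← (key a b c d).2, h]
  · intro h a b
    refine HTensor.ext_inner_tmul fun c d => ?_
    rw [(key a b c d).1, (key a b c d).2, h]

/-- For a commutative product, the Frobenius condition says that the adjoints of multiplication
operators are module maps. -/
theorem isFrobenius_iff (hcomm : ∀ x y, bil μ x y = bil μ y x) :
    IsFrobenius μ ↔
      ∀ a c d, adjoint (bil μ a) (bil μ c d) = bil μ (adjoint (bil μ a) c) d := by
  rw [← map_bil_adjoint_iff]
  have hU : ∀ a t, HTensor.map μ (.id ℂ H)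
      ((HTensor.assoc H H H).symm (.tmul a t)) = HTensor.map (bil μ a) (.id ℂ H) t :=
    fun a t => congrArg (fun g => g t) (map_mul_assoc_symm_tmulL μ a)
  have hL : ∀ b t, HTensor.map (.id ℂ H) μ
      ((HTensor.assoc H H H) (.tmul t b)) = HTensor.map (.id ℂ H) ((bil μ).flip b) t :=
    fun b t => congrArg (fun g => g t) (map_mul_assoc_tmulL μ b)
  constructor
  · intro h a b
    have := congrArg (fun g => g (HTensor.tmul a b)) h.upper
    simpa [HTensor.map_tmul, hU, bil_apply] using this
  · intro h
    have h' := (map_bil_adjoint_iff μ).1 h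
    refine ⟨HTensor.clm_ext fun a b => ?_, HTensor.clm_ext fun a b => ?_⟩
    · simpa [HTensor.map_tmul, hU, bil_apply] using h a b
    · have hflip : (bil μ).flip b = bil μ b := ContinuousLinearMap.ext fun x => hcomm x b
      have : HTensor.map (.id ℂ H) (bil μ b) (adjoint μ a) = adjoint μ (bil μ a b) := by
        refine HTensor.ext_inner_tmul fun c d => ?_
        rw [HTensor.inner_tmul_map, inner_tmul_adjoint, inner_tmul_adjoint, hcomm a b,
          ← ContinuousLinearMap.adjoint_inner_left, hcomm c d, h' b d c,
          ContinuousLinearMap.adjoint_id, ContinuousLinearMap.id_apply, hcomm c]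
      simpa [HTensor.map_tmul, hL, hflip, bil_apply] using this

end Frobenius

section Compact

variable {E F : Type*} [NormedAddCommGroup E] [InnerProductSpace ℂ E]
  [NormedAddCommGroup F] [InnerProductSpace ℂ F]

/-- The operator `a ↦ (b ↦ ⟪t, a ⊗ b⟫)` associated with a Hilbertian tensor. -/
def contract (t : HTensor E F) : E →L[ℂ] F →L[ℂ] ℂ :=
  (ContinuousLinearMap.compL ℂ F (HTensor E F) ℂ (innerSL ℂ t)) ∘L HTensor.tmulL E F

theorem contract_apply (t : HTensor E F) (a : E) (b : F) :
    contract t a b = inner ℂ t (.tmul a b) := rfl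

theorem isCompactOperator_contract (t : HTensor E F) : IsCompactOperator (contract t) := by
  have hcont : Continuous (contract : HTensor E F → _) := by
    unfold contract
    fun_prop
  let S : Submodule ℂ (HTensor E F) :=
    { carrier := {t | IsCompactOperator (contract t)}
      add_mem' := fun {s t} hs ht => by
        have : contract (s + t) = contract s + contract t := by
          ext; simp [contract_apply, inner_add_left]
        change IsCompactOperator (contract (s + t))
        rw [this]
        exact hs.add ht
      zero_mem' := by
        have : contract (0 : HTensor E F) = 0 := by ext; simp [contract_apply]
        change IsCompactOperator (contract (0 : HTensor E F))
        rw [this]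
        exact isCompactOperator_zero
      smul_mem' := fun c t ht => by
        have : contract (c • t) = (starRingEnd ℂ c) • contract t := by
          ext; simp [contract_apply, inner_smul_left]
        change IsCompactOperator (contract (c • t))
        rw [this]
        exact IsCompactOperator.smul (S := ℂ) ht (starRingEnd ℂ c) }
  have hS : S = ⊤ := by
    refine HTensor.dense_of_tmul_mem ?_ fun x y => ?_
    · exact isClosed_setOfPred_isCompactOperator.preimage hcont
    · have : contract (HTensor.tmul x y) =
          ((ContinuousLinearMap.id ℂ ℂ).smulRight (innerSL ℂ y)) ∘L innerSL ℂ x := by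
        ext; simp [contract_apply, HTensor.inner_tmul]
      change IsCompactOperator (contract (HTensor.tmul x y))
      rw [this]
      have h : IsCompactOperator (innerSL ℂ x) :=
        isCompactOperator_of_locallyCompactSpace_dom (innerSL ℂ x)
      exact h.clm_comp ((ContinuousLinearMap.id ℂ ℂ).smulRight (innerSL ℂ y))
  have : t ∈ S := hS ▸ Submodule.mem_top
  exact this

end Compact

/-! ### The structure of commutative Frobenius semigroups -/

section Structure

variable {H : Type*} [NormedAddCommGroup H] [InnerProductSpace ℂ H]

/-- The annihilator of `(H, μ)`. -/
def annihilator (μ : HTensor H H →L[ℂ] H) : Submodule ℂ H := LinearMap.ker (bil μ).toLinearMap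

theorem mem_annihilator {μ : HTensor H H →L[ℂ] H} {x : H} :
    x ∈ annihilator μ ↔ ∀ y, bil μ x y = 0 := by
  rw [annihilator, LinearMap.mem_ker]
  exact ContinuousLinearMap.ext_iff

theorem isClosed_annihilator (μ : HTensor H H →L[ℂ] H) : IsClosed (annihilator μ : Set H) :=
  (bil μ).isClosed_ker

instance [CompleteSpace H] (μ : HTensor H H →L[ℂ] H) : CompleteSpace (annihilator μ) :=
  (isClosed_annihilator μ).completeSpace_coe

/-- A minimal idempotent: a nonzero idempotent `e` with `e H = ℂ e`. -/
structure IsMinIdempotent (μ : HTensor H H →L[ℂ] H) (e : H) : Prop where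
  ne_zero : e ≠ 0
  mul_self : bil μ e e = e
  exists_smul : ∀ b, ∃ c : ℂ, bil μ e b = c • e

variable [CompleteSpace H] {μ : HTensor H H →L[ℂ] H}

omit [CompleteSpace H] in
theorem IsCommSemigroup.bil_comm (hμ : IsCommSemigroup μ) (x y : H) :
    bil μ x y = bil μ y x := hμ.mul_comm x y

omit [CompleteSpace H] in
theorem IsCommSemigroup.bil_assoc (hμ : IsCommSemigroup μ) (x y z : H) :
    bil μ (bil μ x y) z = bil μ x (bil μ y z) := hμ.mul_assoc x y z

variable (hμ : IsCommSemigroup μ) (hF : IsFrobenius μ)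
include hμ hF

theorem adjoint_bil_mul (a c d : H) :
    adjoint (bil μ a) (bil μ c d) = bil μ (adjoint (bil μ a) c) d :=
  (isFrobenius_iff hμ.bil_comm).1 hF a c d

theorem adjoint_bil_mul' (a c d : H) :
    adjoint (bil μ a) (bil μ c d) = bil μ c (adjoint (bil μ a) d) := by
  rw [hμ.bil_comm c d, adjoint_bil_mul hμ hF, hμ.bil_comm]

theorem norm_adjoint_bil (a x : H) : ‖adjoint (bil μ a) x‖ = ‖bil μ a x‖ := by
  have : inner ℂ (adjoint (bil μ a) x) (adjoint (bil μ a) x) =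
      inner ℂ (bil μ a x) (bil μ a x) := by
    rw [ContinuousLinearMap.adjoint_inner_left, ← adjoint_bil_mul' hμ hF,
      ContinuousLinearMap.adjoint_inner_right]
  rw [@norm_eq_sqrt_re_inner ℂ, @norm_eq_sqrt_re_inner ℂ, this]

theorem adjoint_bil_eq_zero_iff {a x : H} : adjoint (bil μ a) x = 0 ↔ bil μ a x = 0 := by
  rw [← norm_eq_zero, norm_adjoint_bil hμ hF, norm_eq_zero]

theorem bil_mul_self_eq_zero {a : H} (h : ∀ x, bil μ a (bil μ a x) = 0) :
    a ∈ annihilator μ := by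
  rw [mem_annihilator]
  intro x
  have h1 := (adjoint_bil_eq_zero_iff hμ hF).2 (h x)
  have h2 : inner ℂ (bil μ a x) (bil μ a x) = 0 := by
    rw [← ContinuousLinearMap.adjoint_inner_right, h1, inner_zero_right]
  exact inner_self_eq_zero.1 h2

theorem IsMinIdempotent.adjoint_bil {e : H} (he : bil μ e e = e) :
    adjoint (bil μ e) = bil μ e := by
  have h1 : adjoint (bil μ e) ∘L bil μ e = adjoint (bil μ e) := by
    ext x
    have : bil μ e (bil μ e x - x) = 0 := by
      rw [map_sub, ← hμ.bil_assoc, he, sub_self]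
    have := (adjoint_bil_eq_zero_iff hμ hF).2 this
    rw [map_sub, sub_eq_zero] at this
    exact this
  have h2 := congrArg adjoint h1
  rw [ContinuousLinearMap.adjoint_comp, ContinuousLinearMap.adjoint_adjoint, h1] at h2
  exact h2

theorem IsMinIdempotent.inner_mul {e : H} (he : IsMinIdempotent μ e) (b : H) :
    inner ℂ e (bil μ e b) = inner ℂ e b := by
  rw [← ContinuousLinearMap.adjoint_inner_left, IsMinIdempotent.adjoint_bil hμ hF he.mul_self,
    he.mul_self]

omit hμ hF [CompleteSpace H] in
theorem IsMinIdempotent.norm_sq_ne_zero {e : H} (he : IsMinIdempotent μ e) :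
    ((‖e‖ : ℂ) ^ 2) ≠ 0 := by
  simpa using he.ne_zero

theorem IsMinIdempotent.bil_eq {e : H} (he : IsMinIdempotent μ e) (b : H) :
    bil μ e b = (inner ℂ e b / (‖e‖ : ℂ) ^ 2) • e := by
  obtain ⟨c, hc⟩ := he.exists_smul b
  have h := he.inner_mul hμ hF b
  rw [hc, inner_smul_right, inner_self_eq_norm_sq_to_K] at h
  rw [hc, ← h]
  congr 1
  exact (mul_div_cancel_right₀ c he.norm_sq_ne_zero).symm

theorem IsMinIdempotent.inner_bil {e : H} (he : IsMinIdempotent μ e) (a b : H) :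
    inner ℂ e (bil μ a b) = inner ℂ e a * inner ℂ e b / (‖e‖ : ℂ) ^ 2 := by
  rw [← he.inner_mul hμ hF, ← hμ.bil_assoc, he.bil_eq hμ hF, map_smul,
    smul_apply, inner_smul_right, he.inner_mul hμ hF]
  ring

/-- Distinct minimal idempotents are orthogonal. -/
theorem IsMinIdempotent.inner_eq_zero {e e' : H} (he : IsMinIdempotent μ e)
    (he' : IsMinIdempotent μ e') (hne : e ≠ e') : inner ℂ e e' = 0 := by
  by_contra h
  have h' : inner ℂ e' e ≠ 0 := fun h0 => h (by rw [← inner_conj_symm, h0, map_zero])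
  have h1 := he.bil_eq hμ hF e'
  rw [hμ.bil_comm, he'.bil_eq hμ hF e] at h1
  set c := inner ℂ e e' / (‖e‖ : ℂ) ^ 2
  set c' := inner ℂ e' e / (‖e'‖ : ℂ) ^ 2
  have hc : c ≠ 0 := div_ne_zero h he.norm_sq_ne_zero
  have hc' : c' ≠ 0 := div_ne_zero h' he'.norm_sq_ne_zero
  have h2 : e = (c⁻¹ * c') • e' := by
    rw [mul_smul, h1, smul_smul, inv_mul_cancel₀ hc, one_smul]
  set k := c⁻¹ * c'
  have hk : k ≠ 0 := mul_ne_zero (inv_ne_zero hc) hc'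
  have h3 := he.mul_self
  rw [h2, map_smul, map_smul, smul_apply, he'.mul_self, smul_smul] at h3
  have h4 : k * k = k := smul_left_injective ℂ he'.ne_zero h3
  have h5 : k = 1 := by
    exact mul_left_cancel₀ hk (by rw [h4, mul_one])
  exact hne (by rw [h2, h5, one_smul])

/-- A joint eigenvector of all multiplication operators outside the annihilator is a multiple of a
minimal idempotent. -/
theorem exists_smul_isMinIdempotent {v : H} (hv : v ∉ annihilator μ)
    (h : ∀ b, ∃ c : ℂ, bil μ b v = c • v) : ∃ c : ℂ, IsMinIdempotent μ (c • v) := by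
  obtain ⟨c, hc⟩ := h v
  have hc0 : c ≠ 0 := by
    rintro rfl
    refine hv (bil_mul_self_eq_zero hμ hF fun x => ?_)
    rw [← hμ.bil_assoc, hc, zero_smul, map_zero, zero_apply]
  have hv0 : v ≠ 0 := fun h0 => hv (h0 ▸ zero_mem _)
  refine ⟨c⁻¹, ⟨smul_ne_zero (inv_ne_zero hc0) hv0, ?_, fun b => ?_⟩⟩
  · rw [map_smul, map_smul, smul_apply, hc, inv_smul_smul₀ hc0]
  · obtain ⟨d, hd⟩ := h b
    exact ⟨d, by rw [map_smul, smul_apply, hμ.bil_comm, hd, smul_comm]⟩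

/-- A nonzero finite-dimensional ideal meeting the annihilator trivially contains a minimal
idempotent. -/
theorem exists_isMinIdempotent_mem (n : ℕ) : ∀ E : Submodule ℂ H, FiniteDimensional ℂ E →
    Module.finrank ℂ E ≤ n → E ≠ ⊥ → (∀ b, ∀ v ∈ E, bil μ b v ∈ E) →
    (∀ v ∈ E, v ∈ annihilator μ → v = 0) → ∃ e ∈ E, IsMinIdempotent μ e := by
  induction n with
  | zero =>
    intro E _ hn hE
    exact absurd (Submodule.finrank_eq_zero.1 (Nat.le_zero.1 hn)) hE
  | succ n ih =>
    intro E _ hn hE hinv hann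
    by_cases hscalar : ∀ b, ∃ c : ℂ, ∀ v ∈ E, bil μ b v = c • v
    · obtain ⟨v, hvE, hv0⟩ := Submodule.exists_mem_ne_zero_of_ne_bot hE
      obtain ⟨c, hc⟩ := exists_smul_isMinIdempotent hμ hF (fun h => hv0 (hann v hvE h))
        fun b => (hscalar b).imp fun c hc => hc v hvE
      exact ⟨c • v, E.smul_mem c hvE, hc⟩
    · push Not at hscalar
      obtain ⟨b, hb⟩ := hscalar
      have : Nontrivial E := Submodule.nontrivial_iff_ne_bot.2 hE
      let T : Module.End ℂ E := (bil μ b).toLinearMap.restrict fun v hv => hinv b v hv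
      obtain ⟨c, hc⟩ := Module.End.exists_eigenvalue T
      obtain ⟨w, hw⟩ := hc.exists_hasEigenvector
      let E' : Submodule ℂ H := E ⊓ LinearMap.ker ((bil μ b).toLinearMap - c • LinearMap.id)
      have hmem : ∀ v, v ∈ E' ↔ v ∈ E ∧ bil μ b v = c • v := fun v => by
        simp [E', sub_eq_zero]
      obtain ⟨v, hvE, hv⟩ := hb c
      have hlt : E' < E := lt_of_le_of_ne inf_le_left fun h =>
        hv ((hmem v).1 (h ▸ hvE)).2
      have : FiniteDimensional ℂ E' := Submodule.finiteDimensional_of_le hlt.le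
      have hle : Module.finrank ℂ E' ≤ n := by
        have := Submodule.finrank_lt_finrank_of_lt hlt
        omega
      have hne : E' ≠ ⊥ := by
        intro h0
        have hw' : (w : H) ∈ E' := (hmem w).2 ⟨w.2, congrArg Subtype.val hw.apply_eq_smul⟩
        rw [h0, Submodule.mem_bot] at hw'
        exact hw.2 (Subtype.ext hw')
      have hinv' : ∀ a, ∀ v ∈ E', bil μ a v ∈ E' := fun a v hv => by
        obtain ⟨h1, h2⟩ := (hmem v).1 hv
        refine (hmem _).2 ⟨hinv a v h1, ?_⟩
        rw [← hμ.bil_assoc, hμ.bil_comm b, hμ.bil_assoc, h2, map_smul]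
      obtain ⟨e, he, he'⟩ := ih E' this hle hne hinv' fun v hv => hann v (hlt.le hv)
      exact ⟨e, hlt.le he, he'⟩

/-- The conjugate-linear operator `a ↦ L_a† c`. -/
def conjOp (μ : HTensor H H →L[ℂ] H) (c : H) : H →L⋆[ℂ] H :=
  ((InnerProductSpace.toDual ℂ H).symm : (H →L[ℂ] ℂ) →L⋆[ℂ] H) ∘SL contract (adjoint μ c)

omit hμ hF in
theorem conjOp_apply (c a : H) : conjOp μ c a = adjoint (bil μ a) c := by
  refine ext_inner_right ℂ fun b => ?_
  rw [ContinuousLinearMap.adjoint_inner_left]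
  change inner ℂ ((InnerProductSpace.toDual ℂ H).symm (contract (adjoint μ c) a)) b = _
  rw [InnerProductSpace.toDual_symm_apply, contract_apply, ContinuousLinearMap.adjoint_inner_left,
    bil_apply]

omit hμ hF in
theorem isCompactOperator_conjOp (c : H) : IsCompactOperator (conjOp μ c) :=
  (isCompactOperator_contract (adjoint μ c)).clm_comp
    ((InnerProductSpace.toDual ℂ H).symm : (H →L[ℂ] ℂ) →L⋆[ℂ] H)

/-- The square of `conjOp`, a positive compact operator commuting with all multiplications. -/
def conjSq (μ : HTensor H H →L[ℂ] H) (c : H) : H →L[ℂ] H := conjOp μ c ∘SL conjOp μ c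

omit hμ hF in
theorem conjSq_apply (c a : H) :
    conjSq μ c a = adjoint (bil μ (adjoint (bil μ a) c)) c := by
  change conjOp μ c (conjOp μ c a) = _
  rw [conjOp_apply, conjOp_apply]

omit hμ hF in
theorem isCompactOperator_conjSq (c : H) : IsCompactOperator (conjSq μ c) :=
  (isCompactOperator_conjOp c).clm_comp (conjOp μ c)

omit hF in
theorem inner_conjSq (c a b : H) :
    inner ℂ (conjSq μ c a) b = inner ℂ (adjoint (bil μ b) c) (adjoint (bil μ a) c) := by
  rw [conjSq_apply, ContinuousLinearMap.adjoint_inner_left, hμ.bil_comm,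
    ContinuousLinearMap.adjoint_inner_left]

omit hF in
theorem isSymmetric_conjSq (c : H) : (conjSq μ c).IsSymmetric := fun a b => by
  change inner ℂ (conjSq μ c a) b = inner ℂ a (conjSq μ c b)
  rw [← inner_conj_symm a, inner_conjSq hμ, inner_conjSq hμ, inner_conj_symm]

theorem conjSq_mul (c b a : H) : conjSq μ c (bil μ b a) = bil μ b (conjSq μ c a) := by
  have h1 : adjoint (bil μ (bil μ b a)) c = adjoint (bil μ b) (adjoint (bil μ a) c) := by
    have : bil μ (bil μ b a) = bil μ a ∘L bil μ b := by
      ext x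
      rw [hμ.bil_comm b a, hμ.bil_assoc]
      rfl
    rw [this, ContinuousLinearMap.adjoint_comp]
    rfl
  have h2 : ∀ x, adjoint (bil μ (adjoint (bil μ b) x)) = adjoint (bil μ x) ∘L bil μ b := fun x => by
    have : bil μ (adjoint (bil μ b) x) = adjoint (bil μ b) ∘L bil μ x := by
      ext y
      exact (adjoint_bil_mul hμ hF b x y).symm
    rw [this, ContinuousLinearMap.adjoint_comp, ContinuousLinearMap.adjoint_adjoint]
  rw [conjSq_apply, conjSq_apply, h1, h2]
  exact adjoint_bil_mul' hμ hF _ _ _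

theorem mem_annihilator_of_forall_inner_eq_zero {x : H}
    (hx : ∀ e, IsMinIdempotent μ e → inner ℂ e x = 0) : x ∈ annihilator μ := by
  let W : Submodule ℂ H := (Submodule.span ℂ {e | IsMinIdempotent μ e})ᗮ
  have hW : ∀ w, w ∈ W ↔ ∀ e, IsMinIdempotent μ e → inner ℂ e w = 0 := fun w => by
    rw [Submodule.mem_orthogonal]
    constructor
    · exact fun h e he => h e (Submodule.subset_span he)
    · intro h u hu
      induction hu using Submodule.span_induction with
      | mem e he => exact h e he
      | zero => simp
      | add a b _ _ ha hb => rw [inner_add_left, ha, hb, add_zero]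
      | smul c a _ ha => rw [inner_smul_left, ha, mul_zero]
  have hmul : ∀ b, ∀ w ∈ W, bil μ b w ∈ W := fun b w hw => (hW _).2 fun e he => by
    rw [he.inner_bil hμ hF, (hW w).1 hw e he, mul_zero, zero_div]
  by_contra hxN
  have hsq : ∃ c, conjSq μ c x ≠ 0 := by
    by_contra! h
    refine hxN (mem_annihilator.2 fun c => ?_)
    have := inner_conjSq hμ c x x
    rw [h c, inner_zero_left] at this
    exact (adjoint_bil_eq_zero_iff hμ hF).1 (inner_self_eq_zero.1 this.symm)
  obtain ⟨c, hc⟩ := hsq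
  have hinv : ∀ w ∈ W, conjSq μ c w ∈ W := fun w hw => (hW _).2 fun e he => by
    have h1 : inner ℂ e (conjSq μ c w) = inner ℂ (conjSq μ c e) w :=
      (isSymmetric_conjSq hμ c e w).symm
    have h2 : conjSq μ c e = bil μ e (conjSq μ c e) := by
      conv_lhs => rw [← he.mul_self]
      exact conjSq_mul hμ hF c e e
    rw [h1, h2, he.bil_eq hμ hF, inner_smul_left, (hW w).1 hw e he, mul_zero]
  let T : W →L[ℂ] W := (conjSq μ c).restrict hinv
  have hTc : IsCompactOperator T := (isCompactOperator_conjSq c).restrict' hinv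
  have hTs : T.IsSymmetric := (isSymmetric_conjSq hμ c).restrict_invariant hinv
  have hT0 : T ≠ 0 := fun h0 => hc (by
    have := congrArg (fun g => ((g ⟨x, (hW x).2 hx⟩ : W) : H)) h0
    exact this)
  obtain ⟨r, hr, hr0⟩ : ∃ r, Module.End.HasEigenvalue (T : Module.End ℂ W) r ∧ r ≠ 0 := by
    by_contra! h
    exact hT0 ((ContinuousLinearMap.eq_zero_of_forall_hasEigenvalue_eq_zero hTc hTs).1 h)
  have hfd := ContinuousLinearMap.finite_dimensional_eigenspace hTc r hr0
  let E : Submodule ℂ H := (Module.End.eigenspace (T : Module.End ℂ W) r).map W.subtype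
  have hE : ∀ v, v ∈ E ↔ v ∈ W ∧ conjSq μ c v = r • v := fun v => by
    constructor
    · rintro ⟨w, hw, rfl⟩
      exact ⟨w.2, congrArg Subtype.val (Module.End.mem_eigenspace_iff.1 hw)⟩
    · rintro ⟨h1, h2⟩
      exact ⟨⟨v, h1⟩, Module.End.mem_eigenspace_iff.2 (Subtype.ext h2), rfl⟩
  have hEfd : FiniteDimensional ℂ E := by
    change FiniteDimensional ℂ (Submodule.map _ _)
    infer_instance
  have hE0 : E ≠ ⊥ := fun h0 => by
    obtain ⟨w, hw⟩ := hr.exists_hasEigenvector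
    have hwE : (w : H) ∈ E := ⟨w, hw.1, rfl⟩
    rw [h0, Submodule.mem_bot] at hwE
    exact hw.2 (Subtype.ext hwE)
  have hEmul : ∀ b, ∀ v ∈ E, bil μ b v ∈ E := fun b v hv => by
    obtain ⟨h1, h2⟩ := (hE v).1 hv
    refine (hE _).2 ⟨hmul b v h1, ?_⟩
    rw [conjSq_mul hμ hF, h2, map_smul]
  have hEann : ∀ v ∈ E, v ∈ annihilator μ → v = 0 := fun v hv hvN => by
    have h2 := ((hE v).1 hv).2
    have h3 : bil μ v = 0 := ContinuousLinearMap.ext (mem_annihilator.1 hvN)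
    rw [conjSq_apply, h3, map_zero, zero_apply, map_zero, map_zero, zero_apply] at h2
    exact (smul_eq_zero.1 h2.symm).resolve_left hr0
  obtain ⟨e, heE, he⟩ := exists_isMinIdempotent_mem hμ hF _ E hEfd le_rfl hE0 hEmul hEann
  exact he.ne_zero (inner_self_eq_zero.1 ((hW e).1 ((hE e).1 heE).1 e he))

theorem mem_annihilator_iff {x : H} :
    x ∈ annihilator μ ↔ ∀ e, IsMinIdempotent μ e → inner ℂ e x = 0 := by
  refine ⟨fun hx e he => ?_, mem_annihilator_of_forall_inner_eq_zero hμ hF⟩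
  rw [← he.inner_mul hμ hF, hμ.bil_comm, mem_annihilator.1 hx, inner_zero_right]

/-- The coordinate of a minimal idempotent is a character. -/
theorem IsMinIdempotent.isMaximalModularIdeal {e : H} (he : IsMinIdempotent μ e) :
    IsMaximalModularIdeal μ (LinearMap.ker (innerSL ℂ e).toLinearMap) := by
  have h0 := he.norm_sq_ne_zero
  have hker : LinearMap.ker (innerSL ℂ e).toLinearMap =
      LinearMap.ker (((‖e‖ : ℂ) ^ 2)⁻¹ • (innerSL ℂ e).toLinearMap) := by
    ext x
    simp [he.ne_zero]
  rw [hker]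
  refine isMaximalModularIdeal_ker (fun x y => ?_) fun h => ?_
  · have := he.inner_bil hμ hF x y
    rw [bil_apply] at this
    simp only [LinearMap.smul_apply, ContinuousLinearMap.coe_coe, innerSL_apply_apply, this,
      smul_eq_mul]
    field_simp
  · have := LinearMap.congr_fun h e
    simp only [LinearMap.smul_apply, ContinuousLinearMap.coe_coe, innerSL_apply_apply,
      inner_self_eq_norm_sq_to_K, smul_eq_mul, LinearMap.zero_apply] at this
    exact one_ne_zero ((inv_mul_cancel₀ h0).symm.trans this)

theorem jacobsonRadical_eq_annihilator : jacobsonRadical μ = annihilator μ := by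
  refine le_antisymm (fun x hx => ?_) (fun x hx => ?_)
  · refine mem_annihilator_of_forall_inner_eq_zero hμ hF fun e he => ?_
    exact (Submodule.mem_sInf.1 hx) _ (he.isMaximalModularIdeal hμ hF)
  · refine Submodule.mem_sInf.2 fun I hI => ?_
    obtain ⟨χ, hχ, rfl⟩ := IsMaximalModularIdeal.exists_character hμ hI
    have : χ x * χ x = 0 := by
      rw [← hχ, ← bil_apply, mem_annihilator.1 hx, map_zero]
    exact LinearMap.mem_ker.2 (mul_self_eq_zero.1 this)

end Structure

/-! ### The model semigroups -/

section WeightedPullback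

variable {α β : Type*}

theorem sum_norm_weightedPullback_le (φ : β → α) (k : β → ℂ) {M : ℝ} (hM : 0 ≤ M)
    (hk : ∀ x, ∀ S : Finset β, (∀ y ∈ S, φ y = x) → ∑ y ∈ S, ‖k y‖ ^ 2 ≤ M)
    (a : lp (fun _ : α => ℂ) 2) (S : Finset β) :
    ∑ y ∈ S, ‖k y * a (φ y)‖ ^ 2 ≤ M * ‖a‖ ^ 2 := by
  classical
  have h2 := lp.sum_rpow_le_norm_rpow (p := 2) (by simp) a (S.image φ)
  simp only [ENNReal.toReal_ofNat, Real.rpow_ofNat] at h2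
  rw [← Finset.sum_fiberwise_of_maps_to (t := S.image φ) (g := φ)
    fun y hy => Finset.mem_image_of_mem φ hy]
  have h3 : ∀ x ∈ S.image φ, ∑ y ∈ S with φ y = x, ‖k y * a (φ y)‖ ^ 2 ≤ M * ‖a x‖ ^ 2 := by
    intro x _
    calc ∑ y ∈ S with φ y = x, ‖k y * a (φ y)‖ ^ 2
        = (∑ y ∈ S with φ y = x, ‖k y‖ ^ 2) * ‖a x‖ ^ 2 := by
          rw [Finset.sum_mul]
          refine Finset.sum_congr rfl fun y hy => ?_
          rw [(Finset.mem_filter.1 hy).2, norm_mul, mul_pow]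
      _ ≤ M * ‖a x‖ ^ 2 :=
          mul_le_mul_of_nonneg_right (hk x _ fun y hy => (Finset.mem_filter.1 hy).2) (sq_nonneg _)
  refine (Finset.sum_le_sum h3).trans ?_
  rw [← Finset.mul_sum]
  exact mul_le_mul_of_nonneg_left h2 hM

/-- The bounded operator `a ↦ (y ↦ k y * a (φ y))` on square-summable functions. -/
def weightedPullback (φ : β → α) (k : β → ℂ) (M : ℝ) (hM : 0 ≤ M)
    (hk : ∀ x, ∀ S : Finset β, (∀ y ∈ S, φ y = x) → ∑ y ∈ S, ‖k y‖ ^ 2 ≤ M) :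
    lp (fun _ : α => ℂ) 2 →L[ℂ] lp (fun _ : β => ℂ) 2 :=
  LinearMap.mkContinuous
    { toFun := fun a => ⟨fun y => k y * a (φ y), memℓp_gen' (C := M * ‖a‖ ^ 2) fun S => by
        simpa using sum_norm_weightedPullback_le φ k hM hk a S⟩
      map_add' := fun a b => Subtype.ext (funext fun y => mul_add (k y) (a (φ y)) (b (φ y)))
      map_smul' := fun c a => Subtype.ext (funext fun y => mul_left_comm (k y) c (a (φ y))) }
    (Real.sqrt M) fun a => by
      refine lp.norm_le_of_forall_sum_le (by simp) (by positivity) fun S => ?_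
      have := sum_norm_weightedPullback_le φ k hM hk a S
      simpa [mul_pow, Real.sq_sqrt hM] using this

end WeightedPullback

theorem WSet.weight_pos (X : WSet.{u}) (x : X.carrier) : 0 < X.weight x := by
  obtain ⟨C, hC, h⟩ := X.weight_bound
  exact hC.trans_le (h x)

/-- The square root of the weight, as a complex number. -/
def WSet.root (X : WSet.{u}) (x : X.carrier) : ℂ := (Real.sqrt (X.weight x) : ℝ)

theorem WSet.root_ne_zero (X : WSet.{u}) (x : X.carrier) : X.root x ≠ 0 := by
  simpa [WSet.root] using (Real.sqrt_pos.2 (X.weight_pos x)).ne'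

theorem WSet.norm_root_sq (X : WSet.{u}) (x : X.carrier) : ‖X.root x‖ ^ 2 = X.weight x := by
  simp [WSet.root, Real.sq_sqrt (X.weight_pos x).le]

theorem WSet.conj_root (X : WSet.{u}) (x : X.carrier) : starRingEnd ℂ (X.root x) = X.root x :=
  Complex.conj_ofReal _

/-- The Hilbert space `ℓ²(X) ⊕ V`. -/
abbrev ModelSpace (X : WSet.{u}) (V : Hilb.{u}) : Type u :=
  WithLp 2 (lp (fun _ : X.carrier => ℂ) 2 × V)

namespace ModelSpace

variable (X : WSet.{u}) (V : Hilb.{u})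

open scoped Classical in
/-- The standard unit vectors. -/
def unitVec (x : X.carrier) : ModelSpace X V := toLp 2 (lp.single 2 x 1, 0)

variable {X V}

theorem inner_unitVec (x : X.carrier) (a : ModelSpace X V) :
    inner ℂ (unitVec X V x) a = a.fst x := by
  classical
  simp only [unitVec, WithLp.prod_inner_apply]
  rw [lp.inner_single_left]
  simp

theorem unitVec_fst_self (x : X.carrier) : (unitVec X V x).fst x = 1 := by
  classical
  simp [unitVec]

theorem unitVec_fst_of_ne {x y : X.carrier} (h : y ≠ x) : (unitVec X V x).fst y = 0 := by
  classical
  simp [unitVec, h]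

/-- Evaluation at a point: the coordinates normalized so that they are characters. -/
def ev (x : X.carrier) : ModelSpace X V →L[ℂ] ℂ := innerSL ℂ ((X.root x)⁻¹ • unitVec X V x)

theorem ev_apply (x : X.carrier) (a : ModelSpace X V) : ev x a = (X.root x)⁻¹ * a.fst x := by
  rw [ev, innerSL_apply_apply, inner_smul_left, inner_unitVec, map_inv₀, X.conj_root]

theorem fst_apply (x : X.carrier) (a : ModelSpace X V) : a.fst x = X.root x * ev x a := by
  rw [ev_apply, mul_inv_cancel_left₀ (X.root_ne_zero x)]

@[ext]
theorem ext {a b : ModelSpace X V} (h : ∀ x, ev x a = ev x b) (h' : a.snd = b.snd) : a = b := by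
  have h1 : a.fst = b.fst := by
    ext x
    rw [fst_apply, fst_apply, h]
  exact WithLp.ofLp_injective 2 (Prod.ext h1 h')

variable (X V) in
/-- The minimal idempotents of the model. -/
def idem (x : X.carrier) : ModelSpace X V := X.root x • unitVec X V x

theorem ev_idem_self (x : X.carrier) : ev x (idem X V x) = 1 := by
  simp [ev_apply, idem, unitVec_fst_self, X.root_ne_zero]

theorem ev_idem_of_ne {x y : X.carrier} (h : y ≠ x) : ev y (idem X V x) = 0 := by
  simp [ev_apply, idem, unitVec_fst_of_ne h]

theorem idem_snd (x : X.carrier) : (idem X V x).snd = 0 := by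
  simp [idem, unitVec]

theorem inner_idem (x : X.carrier) (a : ModelSpace X V) :
    inner ℂ (idem X V x) a = X.weight x * ev x a := by
  rw [idem, inner_smul_left, inner_unitVec, fst_apply, ← mul_assoc, X.conj_root, ← X.norm_root_sq]
  congr 1
  rw [WSet.root, Complex.norm_real, Real.norm_eq_abs, sq_abs, sq, Complex.ofReal_mul]

theorem norm_idem_sq (x : X.carrier) : ‖idem X V x‖ ^ 2 = X.weight x := by
  have : ((‖idem X V x‖ ^ 2 : ℝ) : ℂ) = (X.weight x : ℝ) := by
    push_cast
    have := inner_self_eq_norm_sq_to_K (𝕜 := ℂ) (idem X V x)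
    rw [inner_idem, ev_idem_self, mul_one] at this
    exact this.symm
  exact_mod_cast this

variable (X V) in
/-- The inclusion of the second summand. -/
def inr : V →L[ℂ] ModelSpace X V :=
  (WithLp.prodContinuousLinearEquiv 2 ℂ (lp (fun _ : X.carrier => ℂ) 2) V).symm.toContinuousLinearMap ∘L
    ContinuousLinearMap.inr ℂ _ _

theorem ev_inr (x : X.carrier) (v : V) : ev x (inr X V v) = 0 := by
  have : (inr X V v).fst = 0 := rfl
  rw [ev_apply, this]
  simp

/-- A bounded operator on the model is determined by its values on idempotents and on the second
summand. -/
theorem clm_ext {E : Type*} [NormedAddCommGroup E] [NormedSpace ℂ E]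
    {f g : ModelSpace X V →L[ℂ] E} (h : ∀ x, f (idem X V x) = g (idem X V x))
    (h' : ∀ v, f (inr X V v) = g (inr X V v)) : f = g := by
  classical
  let inl : lp (fun _ : X.carrier => ℂ) 2 →L[ℂ] ModelSpace X V :=
    (WithLp.prodContinuousLinearEquiv 2 ℂ _ V).symm.toContinuousLinearMap ∘L
      ContinuousLinearMap.inl ℂ _ _
  have h1 : ∀ a, f (inl a) = g (inl a) := fun a => by
    have hs := lp.hasSum_single (p := 2) (by simp) a
    have hf := hs.map (f ∘L inl) (f ∘L inl).continuous
    have hg := hs.map (g ∘L inl) (g ∘L inl).continuous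
    have hfg : ∀ x, f (inl (lp.single (E := fun _ => ℂ) 2 x (a x))) =
        g (inl (lp.single (E := fun _ => ℂ) 2 x (a x))) := fun x => ?_
    · exact hf.unique ((funext hfg : (f ∘L inl) ∘ _ = (g ∘L inl) ∘ _) ▸ hg)
    have hx : inl (lp.single (E := fun _ => ℂ) 2 x (a x)) = (a x * (X.root x)⁻¹) • idem X V x := by
      rw [idem, smul_smul, mul_assoc, inv_mul_cancel₀ (X.root_ne_zero x), mul_one, unitVec]
      refine WithLp.ofLp_injective 2 (Prod.ext ?_ ?_)
      · change lp.single (E := fun _ => ℂ) 2 x (a x) = a x • lp.single (E := fun _ => ℂ) 2 x 1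
        rw [← lp.single_smul, smul_eq_mul, mul_one]
      · change (0 : V) = a x • 0
        rw [smul_zero]
    rw [hx, map_smul, map_smul, h]
  ext a
  have ha : a = inl a.fst + inr X V a.snd := by
    refine WithLp.ofLp_injective 2 (Prod.ext ?_ ?_)
    · change a.fst = a.fst + 0
      rw [add_zero]
    · change a.snd = 0 + a.snd
      rw [zero_add]
  rw [ha, map_add, map_add, h1, h']

variable (X V) in
theorem orthonormal_tmul_unitVec :
    Orthonormal ℂ fun x => HTensor.tmul (unitVec X V x) (unitVec X V x) := by
  classical
  rw [orthonormal_iff_ite]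
  intro x y
  rw [HTensor.inner_tmul, inner_unitVec]
  split_ifs with h
  · subst h; simp [unitVec_fst_self]
  · simp [unitVec_fst_of_ne h]

variable (X) in
theorem exists_inv_root_bound : ∃ M : ℝ, 0 ≤ M ∧ ∀ x, ∀ S : Finset X.carrier, (∀ y ∈ S, y = x) →
    ∑ y ∈ S, ‖(X.root y)⁻¹‖ ^ 2 ≤ M := by
  classical
  obtain ⟨C, hC, h⟩ := X.weight_bound
  refine ⟨C⁻¹, by positivity, fun x S hS => ?_⟩
  have hsub : S ⊆ {x} := fun y hy => Finset.mem_singleton.2 (hS y hy)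
  refine (Finset.sum_le_sum_of_subset_of_nonneg hsub fun _ _ _ => sq_nonneg _).trans ?_
  rw [Finset.sum_singleton, norm_inv, inv_pow, X.norm_root_sq]
  exact inv_anti₀ hC (h x)

variable (X) in
/-- Division by the square root of the weight. -/
def divRoot : lp (fun _ : X.carrier => ℂ) 2 →L[ℂ] lp (fun _ : X.carrier => ℂ) 2 :=
  weightedPullback id (fun x => (X.root x)⁻¹) _ (exists_inv_root_bound X).choose_spec.1
    (exists_inv_root_bound X).choose_spec.2

theorem divRoot_apply (a : lp (fun _ : X.carrier => ℂ) 2) (x : X.carrier) :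
    divRoot X a x = (X.root x)⁻¹ * a x := rfl

variable (X V) in
/-- The comultiplication of the model. -/
def comul : ModelSpace X V →L[ℂ] HTensor (ModelSpace X V) (ModelSpace X V) :=
  (orthonormal_tmul_unitVec X V).orthogonalFamily.linearIsometry.toContinuousLinearMap ∘L
    divRoot X ∘L WithLp.fstL 2 ℂ _ _

theorem comul_unitVec (x : X.carrier) : comul X V (unitVec X V x) =
    (X.root x)⁻¹ • HTensor.tmul (unitVec X V x) (unitVec X V x) := by
  classical
  have h : divRoot X (lp.single 2 x 1) = lp.single 2 x (X.root x)⁻¹ := by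
    ext y
    rw [divRoot_apply]
    by_cases hy : y = x
    · subst hy; simp
    · simp [hy]
  have h2 : comul X V (unitVec X V x) =
      (orthonormal_tmul_unitVec X V).orthogonalFamily.linearIsometry
        (divRoot X (lp.single 2 x 1)) := by
    simp [comul, unitVec]
  rw [h2, h, OrthogonalFamily.linearIsometry_apply_single]
  rfl

theorem comul_inr (v : V) : comul X V (inr X V v) = 0 := by
  have : (inr X V v).fst = 0 := rfl
  simp [comul, this]

variable (X V) in
/-- The multiplication of the model. -/
def mul : HTensor (ModelSpace X V) (ModelSpace X V) →L[ℂ] ModelSpace X V := adjoint (comul X V)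

theorem ev_mul (x : X.carrier) (a b : ModelSpace X V) :
    ev x (mul X V (.tmul a b)) = ev x a * ev x b := by
  rw [ev_apply, ← inner_unitVec, mul, ContinuousLinearMap.adjoint_inner_right, comul_unitVec,
    inner_smul_left, HTensor.inner_tmul, inner_unitVec, inner_unitVec, ev_apply, ev_apply, map_inv₀,
    X.conj_root]
  ring

theorem inner_inr (v : V) (a : ModelSpace X V) : inner ℂ (inr X V v) a = inner ℂ v a.snd := by
  have : (inr X V v).fst = 0 := rfl
  rw [WithLp.prod_inner_apply]
  change inner ℂ (inr X V v).fst a.fst + inner ℂ v a.snd = _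
  rw [this, inner_zero_left, zero_add]

theorem mul_snd (a b : ModelSpace X V) : (mul X V (.tmul a b)).snd = 0 := by
  refine ext_inner_left ℂ fun v => ?_
  rw [← inner_inr, mul, ContinuousLinearMap.adjoint_inner_right, comul_inr, inner_zero_left,
    inner_zero_right]

theorem isCommSemigroup_mul : IsCommSemigroup (mul X V) where
  assoc := HTensor.clm_ext₃ fun a b c => by
    ext x
    · simp [HTensor.map_tmul, HTensor.assoc_tmul, ev_mul, mul_assoc]
    · simp [HTensor.map_tmul, HTensor.assoc_tmul, mul_snd]
  comm := HTensor.clm_ext fun a b => by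
    ext x
    · simp [HTensor.comm_tmul, ev_mul, mul_comm]
    · simp [HTensor.comm_tmul, mul_snd]

theorem mul_unitVec (a : ModelSpace X V) (x : X.carrier) :
    mul X V (.tmul a (unitVec X V x)) = ev x a • unitVec X V x := by
  ext y
  · rw [ev_mul, map_smul, smul_eq_mul]
    by_cases h : y = x
    · rw [h]
    · rw [ev_apply y (unitVec X V x), unitVec_fst_of_ne h, mul_zero, mul_zero, mul_zero]
  · rw [mul_snd]
    simp [unitVec]

theorem mul_inr (a : ModelSpace X V) (v : V) : mul X V (.tmul a (inr X V v)) = 0 := by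
  ext y
  · rw [ev_mul, ev_inr, mul_zero, map_zero]
  · rw [mul_snd, WithLp.zero_snd]

theorem ev_adjoint (a b : ModelSpace X V) (x : X.carrier) :
    ev x (adjoint (bil (mul X V) a) b) = starRingEnd ℂ (ev x a) * ev x b := by
  rw [ev_apply, ← inner_unitVec, ContinuousLinearMap.adjoint_inner_right, bil_apply, mul_unitVec,
    inner_smul_left, inner_unitVec, ev_apply x b]
  ring

theorem adjoint_snd (a b : ModelSpace X V) : (adjoint (bil (mul X V) a) b).snd = 0 := by
  refine ext_inner_left ℂ fun v => ?_
  rw [← inner_inr, ContinuousLinearMap.adjoint_inner_right, bil_apply, mul_inr, inner_zero_left,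
    inner_zero_right]

theorem isFrobenius_mul : IsFrobenius (mul X V) := by
  refine (isFrobenius_iff isCommSemigroup_mul.mul_comm).2 fun a c d => ?_
  ext x
  · rw [ev_adjoint, bil_apply, bil_apply, ev_mul, ev_mul, ev_adjoint, mul_assoc]
  · rw [adjoint_snd, bil_apply, mul_snd]

theorem mul_idem (a : ModelSpace X V) (x : X.carrier) :
    mul X V (.tmul a (idem X V x)) = ev x a • idem X V x := by
  have := congrArg (fun t => X.root x • t) (mul_unitVec a x)
  rw [smul_comm] at this
  rw [← bil_apply] at this ⊢
  rw [idem, map_smul]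
  exact this

end ModelSpace

/-- The Frobenius semigroup `ℓ²(X) ⊕ V`, with pointwise product on the first summand and zero
product on the second one. -/
def model (X : WSet.{u}) (V : Hilb.{u}) : FrobSem.{u} where
  carrier := ModelSpace X V
  mul := ModelSpace.mul X V
  isCommSemigroup := ModelSpace.isCommSemigroup_mul
  isFrobenius := ModelSpace.isFrobenius_mul

/-! ### The model functor -/

theorem IsProper.of_surjective {H K : Type*} [NormedAddCommGroup H] [InnerProductSpace ℂ H]
    [NormedAddCommGroup K] [InnerProductSpace ℂ K] (γ : HTensor K K →L[ℂ] K) {f : H →L[ℂ] K}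
    (hf : Function.Surjective f) : IsProper γ f := fun _ hI h =>
  hI.ne_top (eq_top_iff.2 fun y _ => by
    obtain ⟨x, rfl⟩ := hf y
    exact h ⟨x, rfl⟩)

theorem IsSemigroupMap.of_apply {H K : Type*} [NormedAddCommGroup H] [InnerProductSpace ℂ H]
    [NormedAddCommGroup K] [InnerProductSpace ℂ K] {μ : HTensor H H →L[ℂ] H}
    {γ : HTensor K K →L[ℂ] K} {f : H →L[ℂ] K}
    (h : ∀ x y, f (μ (.tmul x y)) = γ (.tmul (f x) (f y))) : IsSemigroupMap μ γ f :=
  HTensor.clm_ext fun x y => by simpa [HTensor.map_tmul] using h x y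

/-- A multiplicative topological isomorphism is an isomorphism in the category of Frobenius
semigroups and proper morphisms. -/
def FrobSem.isoOfMul {A B : FrobSem.{u}} (U : A.toHilb ≃L[ℂ] B.toHilb)
    (hU : ∀ x y, U (A.mul (.tmul x y)) = B.mul (.tmul (U x) (U y))) : A ≅ B where
  hom := ⟨U.toContinuousLinearMap, .of_apply hU, .of_surjective _ U.surjective⟩
  inv := ⟨U.symm.toContinuousLinearMap, .of_apply fun x y => U.injective (by
    simp [hU]), .of_surjective _ U.symm.surjective⟩
  hom_inv_id := FrobSem.ProperHom.ext (ContinuousLinearMap.ext U.symm_apply_apply)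
  inv_hom_id := FrobSem.ProperHom.ext (ContinuousLinearMap.ext U.apply_symm_apply)

namespace ModelSpace

variable {X Y : WSet.{u}} {V W : Hilb.{u}}

theorem isMaximalModularIdeal_ker_ev (x : X.carrier) :
    IsMaximalModularIdeal (mul X V) (LinearMap.ker (ev x).toLinearMap) :=
  isMaximalModularIdeal_ker (ev_mul x) fun h => by
    have := LinearMap.congr_fun h (idem X V x)
    rw [ContinuousLinearMap.coe_coe, ev_idem_self] at this
    exact one_ne_zero this

theorem exists_idem_notMem {I : Submodule ℂ (ModelSpace X V)}
    (hI : IsMaximalModularIdeal (mul X V) I) : ∃ x, idem X V x ∉ I := by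
  by_contra! h
  have hinr : ∀ v, inr X V v ∈ I := fun v => by
    obtain ⟨χ, hχ, rfl⟩ := hI.exists_character isCommSemigroup_mul
    refine LinearMap.mem_ker.2 (mul_self_eq_zero.1 ?_)
    rw [← hχ, mul_inr, map_zero]
  have : CompleteSpace I := hI.isClosed.completeSpace_coe
  refine hI.ne_top ((Submodule.orthogonal_eq_bot_iff).1 (eq_bot_iff.2 fun z hz => ?_))
  rw [Submodule.mem_orthogonal'] at hz
  have hz0 : innerSL ℂ z = 0 := clm_ext (fun x => hz _ (h x)) fun v => hz _ (hinr v)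
  have := congrArg (fun f => f z) hz0
  exact inner_self_eq_zero.1 this

theorem exists_pullback_bound (φ : WSet.Hom Y X) : ∃ M : ℝ, 0 ≤ M ∧
    ∀ x, ∀ S : Finset Y.carrier, (∀ y ∈ S, φ.toFun y = x) →
      ∑ y ∈ S, ‖Y.root y * (X.root (φ.toFun y))⁻¹‖ ^ 2 ≤ M := by
  obtain ⟨M, hM, h⟩ := φ.weight_le
  refine ⟨M, hM, fun x S hS => ?_⟩
  have h1 : ∀ y ∈ S, ‖Y.root y * (X.root (φ.toFun y))⁻¹‖ ^ 2 = Y.weight y / X.weight x := by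
    intro y hy
    rw [hS y hy, norm_mul, mul_pow, norm_inv, inv_pow, Y.norm_root_sq, X.norm_root_sq]
    rfl
  rw [Finset.sum_congr rfl h1, ← Finset.sum_div, div_le_iff₀ (X.weight_pos x)]
  refine le_trans (Finset.sum_le_sum_of_subset_of_nonneg (fun y hy => ?_) fun y _ _ =>
    (Y.weight_pos y).le) (h x)
  simpa using hS y hy

/-- The operator between models induced by a map of weighted sets and a bounded operator. -/
def map (φ : WSet.Hom Y X) (g : V →L[ℂ] W) : ModelSpace X V →L[ℂ] ModelSpace Y W :=
  (WithLp.prodContinuousLinearEquiv 2 ℂ (lp (fun _ : Y.carrier => ℂ) 2)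
    W).symm.toContinuousLinearMap ∘L
    ((weightedPullback φ.toFun _ _ (exists_pullback_bound φ).choose_spec.1
      (exists_pullback_bound φ).choose_spec.2 ∘L WithLp.fstL 2 ℂ _ _).prod
      (g ∘L WithLp.sndL 2 ℂ _ _))

theorem ev_map (φ : WSet.Hom Y X) (g : V →L[ℂ] W) (a : ModelSpace X V) (y : Y.carrier) :
    ev y (map φ g a) = ev (φ.toFun y) a := by
  have h : (map φ g a).fst y = Y.root y * (X.root (φ.toFun y))⁻¹ * a.fst (φ.toFun y) := rfl
  rw [ev_apply, ev_apply, h, mul_assoc, inv_mul_cancel_left₀ (Y.root_ne_zero y)]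

theorem map_snd (φ : WSet.Hom Y X) (g : V →L[ℂ] W) (a : ModelSpace X V) :
    (map φ g a).snd = g a.snd := rfl

theorem isSemigroupMap_map (φ : WSet.Hom Y X) (g : V →L[ℂ] W) :
    IsSemigroupMap (mul X V) (mul Y W) (map φ g) := .of_apply fun a b => by
  ext y
  · rw [ev_map, ev_mul, ev_mul, ev_map, ev_map]
  · rw [map_snd, mul_snd, mul_snd, map_zero]

theorem isProper_map (φ : WSet.Hom Y X) (g : V →L[ℂ] W) : IsProper (mul Y W) (map φ g) := by
  intro I hI hle
  obtain ⟨y, hy⟩ := exists_idem_notMem hI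
  have h := (hI.isIdeal (idem Y W y) _ (hle ⟨idem X V (φ.toFun y), rfl⟩)).2
  rw [mul_idem, ContinuousLinearMap.coe_coe, ev_map, ev_idem_self, one_smul] at h
  exact hy h

theorem map_injective {φ φ' : WSet.Hom Y X} {g g' : V →L[ℂ] W} (h : map φ g = map φ' g') :
    φ = φ' ∧ g = g' := by
  constructor
  · refine WSet.Hom.ext (funext fun y => ?_)
    by_contra hne
    have h1 := ev_map φ g (idem X V (φ.toFun y)) y
    rw [h, ev_map, ev_idem_self, ev_idem_of_ne (Ne.symm hne)] at h1
    exact zero_ne_one h1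
  · ext v
    have := congrArg (fun f => (f (inr X V v)).snd) h
    exact this

section Full

variable {f : ModelSpace X V →L[ℂ] ModelSpace Y W}
  (hf : IsSemigroupMap (mul X V) (mul Y W) f)
include hf

theorem exists_ev_comp (hp : IsProper (mul Y W) f) (y : Y.carrier) :
    ∃ x, ∀ a, ev y (f a) = ev x a := by
  have hψ : ∀ a b, ev y (f (mul X V (.tmul a b))) = ev y (f a) * ev y (f b) := fun a b => by
    rw [hf.apply, ev_mul]
  have hinr : ∀ v, ev y (f (inr X V v)) = 0 := fun v => by
    refine mul_self_eq_zero.1 ?_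
    rw [← hψ, mul_inr, map_zero, map_zero]
  obtain ⟨x, hx⟩ : ∃ x, ev y (f (idem X V x)) ≠ 0 := by
    by_contra! h
    have h0 : ev y ∘L f = 0 := clm_ext h hinr
    refine hp _ (isMaximalModularIdeal_ker_ev y) ?_
    rintro _ ⟨a, rfl⟩
    exact congrArg (fun k => k a) h0
  refine ⟨x, fun a => mul_right_cancel₀ hx ?_⟩
  rw [← hψ, mul_idem, map_smul, map_smul, smul_eq_mul]

omit hf in
theorem sum_weight_le {φ : Y.carrier → X.carrier} (hφ : ∀ y a, ev y (f a) = ev (φ y) a)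
    (x : X.carrier) (S : Finset Y.carrier) (hS : ∀ y ∈ S, φ y = x) :
    ∑ y ∈ S, Y.weight y ≤ ‖f‖ ^ 2 * X.weight x := by
  have h1 : ∀ y ∈ S, Y.weight y = ‖(f (idem X V x)).fst y‖ ^ 2 := fun y hy => by
    rw [fst_apply, hφ, hS y hy, ev_idem_self, mul_one, Y.norm_root_sq]
  have h2 := lp.sum_rpow_le_norm_rpow (p := 2) (by simp) (f (idem X V x)).fst S
  simp only [ENNReal.toReal_ofNat, Real.rpow_ofNat] at h2
  have h3 : ‖(f (idem X V x)).fst‖ ^ 2 ≤ ‖f (idem X V x)‖ ^ 2 := by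
    rw [WithLp.prod_norm_sq_eq_of_L2]
    exact le_add_of_nonneg_right (sq_nonneg _)
  calc ∑ y ∈ S, Y.weight y = ∑ y ∈ S, ‖(f (idem X V x)).fst y‖ ^ 2 := Finset.sum_congr rfl h1
    _ ≤ ‖f (idem X V x)‖ ^ 2 := h2.trans h3
    _ ≤ (‖f‖ * ‖idem X V x‖) ^ 2 := by gcongr; exact f.le_opNorm _
    _ = ‖f‖ ^ 2 * X.weight x := by rw [mul_pow, norm_idem_sq]

omit hf in
theorem finite_fiber {φ : Y.carrier → X.carrier} (hφ : ∀ y a, ev y (f a) = ev (φ y) a)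
    (x : X.carrier) : (φ ⁻¹' {x}).Finite := by
  by_contra hinf
  obtain ⟨C, hC, h⟩ := Y.weight_bound
  obtain ⟨n, hn⟩ := exists_nat_gt (‖f‖ ^ 2 * X.weight x / C)
  obtain ⟨S, hS, hcard⟩ := Set.Infinite.exists_subset_card_eq hinf n
  have h1 := sum_weight_le hφ x S fun y hy => hS hy
  have h2 : (n : ℝ) * C ≤ ∑ y ∈ S, Y.weight y := by
    rw [← hcard, ← nsmul_eq_mul]
    exact Finset.card_nsmul_le_sum _ _ _ fun y _ => h y
  rw [div_lt_iff₀ hC] at hn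
  linarith

theorem exists_eq_map (hp : IsProper (mul Y W) f) :
    ∃ (φ : WSet.Hom Y X) (g : V →L[ℂ] W), map φ g = f := by
  choose φ hφ using exists_ev_comp hf hp
  let Φ : WSet.Hom Y X :=
    { toFun := φ
      finite_fiber := finite_fiber hφ
      weight_le := ⟨‖f‖ ^ 2, sq_nonneg _, fun x => sum_weight_le hφ x _ fun y hy => by
        simpa using hy⟩ }
  let g : V →L[ℂ] W := WithLp.sndL 2 ℂ _ _ ∘L f ∘L inr X V
  have hsnd : WithLp.sndL 2 ℂ _ _ ∘L f = g ∘L WithLp.sndL 2 ℂ _ _ := by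
    refine clm_ext (fun x => ?_) fun v => rfl
    have h1 : f (idem X V x) = mul Y W (.tmul (f (idem X V x)) (f (idem X V x))) := by
      rw [← hf.apply, mul_idem, ev_idem_self, one_smul]
    change (f (idem X V x)).snd = g (idem X V x).snd
    rw [h1, mul_snd, idem_snd, map_zero]
  refine ⟨Φ, g, ContinuousLinearMap.ext fun a => ?_⟩
  ext y
  · rw [ev_map, hφ]
  · rw [map_snd]
    exact (congrArg (fun k => k a) hsnd).symm

end Full

end ModelSpace

/-- The functor sending a weighted set `X` and a Hilbert space `V` to the Frobenius semigroup
`ℓ²(X) ⊕ V`. -/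
def modelFunctor : WSet.{u}ᵒᵖ × Hilb.{u} ⥤ FrobSem.{u} where
  obj P := model P.1.unop P.2
  map {P Q} f := (⟨ModelSpace.map f.1.unop f.2, ModelSpace.isSemigroupMap_map _ _,
    ModelSpace.isProper_map _ _⟩ : FrobSem.ProperHom (model P.1.unop P.2) (model Q.1.unop Q.2))
  map_id _ := FrobSem.ProperHom.ext (ContinuousLinearMap.ext fun _ => ModelSpace.ext
    (fun _ => ModelSpace.ev_map _ _ _ _) rfl)
  map_comp _ _ := FrobSem.ProperHom.ext (ContinuousLinearMap.ext fun _ => ModelSpace.ext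
    (fun _ => (ModelSpace.ev_map _ _ _ _).trans
      ((ModelSpace.ev_map _ _ _ _).trans (ModelSpace.ev_map _ _ _ _)).symm) rfl)

instance : modelFunctor.{u}.Faithful where
  map_injective {P Q} f g h := by
    obtain ⟨h1, h2⟩ := ModelSpace.map_injective (congrArg FrobSem.ProperHom.toCLM h)
    exact Prod.ext (Quiver.Hom.unop_inj h1) h2

instance : modelFunctor.{u}.Full where
  map_surjective {P Q} f := by
    obtain ⟨φ, g, h⟩ := ModelSpace.exists_eq_map f.isSemigroupMap f.isProper
    exact ⟨(Quiver.Hom.op (V := WSet.{u}) (X := Q.1.unop) (Y := P.1.unop) φ, g),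
      FrobSem.ProperHom.ext h⟩

/-! ### Essential surjectivity -/

namespace FrobSem

variable (A : FrobSem.{u})

/-- The minimal idempotents of a Frobenius semigroup. -/
abbrev Idem : Type u := {e : A.toHilb // IsMinIdempotent A.mul e}

theorem exists_le_norm_sq : ∃ C : ℝ, 0 < C ∧ ∀ e : A.Idem, C ≤ ‖e.1‖ ^ 2 := by
  refine ⟨((‖A.mul‖ + 1)⁻¹) ^ 2, by positivity, fun e => ?_⟩
  have hpos : 0 < ‖e.1‖ := norm_pos_iff.2 e.2.ne_zero
  have h1 : ‖e.1‖ ≤ ‖A.mul‖ * (‖e.1‖ * ‖e.1‖) := by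
    conv_lhs => rw [← e.2.mul_self, bil_apply]
    rw [← HTensor.norm_tmul]
    exact A.mul.le_opNorm _
  have h2 : 1 ≤ ‖A.mul‖ * ‖e.1‖ := by
    refine le_of_mul_le_mul_right ?_ hpos
    linarith
  have h3 : (‖A.mul‖ + 1)⁻¹ ≤ ‖e.1‖ := by
    rw [inv_le_iff_one_le_mul₀ (by positivity)]
    nlinarith
  gcongr

/-- The weighted set of minimal idempotents. -/
abbrev idemWSet : WSet.{u} where
  carrier := A.Idem
  weight e := ‖e.1‖ ^ 2
  weight_bound := A.exists_le_norm_sq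

/-- The annihilator, as a Hilbert space. -/
abbrev radHilb : Hilb.{u} where
  carrier := annihilator A.mul

theorem root_idemWSet (e : A.Idem) : A.idemWSet.root e = (‖e.1‖ : ℂ) := by
  have : A.idemWSet.weight e = ‖e.1‖ ^ 2 := rfl
  rw [WSet.root, this, Real.sqrt_sq (norm_nonneg _)]

theorem orthonormal_idem :
    Orthonormal ℂ fun e : A.idemWSet.carrier => (A.idemWSet.root e)⁻¹ • e.1 := by
  constructor
  · intro e
    rw [norm_smul, norm_inv, root_idemWSet, Complex.norm_real, norm_norm,
      inv_mul_cancel₀ (norm_ne_zero_iff.2 e.2.ne_zero)]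
  · intro e e' hne
    change inner ℂ ((A.idemWSet.root e)⁻¹ • e.1) ((A.idemWSet.root e')⁻¹ • e'.1) = 0
    rw [inner_smul_left, inner_smul_right, e.2.inner_eq_zero A.isCommSemigroup A.isFrobenius e'.2
      (fun h => hne (Subtype.ext h)), mul_zero, mul_zero]

/-- The isometry from `ℓ²` of the minimal idempotents onto their closed span. -/
def idemIsometry : lp (fun _ : A.idemWSet.carrier => ℂ) 2 →ₗᵢ[ℂ] A.toHilb :=
  A.orthonormal_idem.orthogonalFamily.linearIsometry

theorem inner_idemIsometry (c : lp (fun _ : A.idemWSet.carrier => ℂ) 2) {n : A.toHilb}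
    (hn : n ∈ annihilator A.mul) : inner ℂ n (A.idemIsometry c) = 0 := by
  have h := (A.orthonormal_idem.orthogonalFamily.hasSum_linearIsometry c).mapL (innerSL ℂ n)
  refine h.unique ?_
  convert hasSum_zero using 1
  funext e
  have h0 : inner ℂ n e.1 = 0 := by
    rw [← inner_conj_symm, (mem_annihilator_iff A.isCommSemigroup A.isFrobenius).1 hn e.1 e.2,
      map_zero]
  change inner ℂ n (c e • ((A.idemWSet.root e)⁻¹ • e.1)) = 0
  rw [inner_smul_right, inner_smul_right, h0, mul_zero, mul_zero]

/-- The isometry from the model onto a Frobenius semigroup. -/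
def modelIsometry : ModelSpace A.idemWSet A.radHilb →ₗᵢ[ℂ] A.toHilb where
  toLinearMap := (A.idemIsometry.toContinuousLinearMap ∘L WithLp.fstL 2 ℂ _ _ +
    (annihilator A.mul).subtypeL ∘L WithLp.sndL 2 ℂ _ _).toLinearMap
  norm_map' a := by
    have h : ‖A.idemIsometry a.fst + (a.snd : annihilator A.mul).1‖ ^ 2 = ‖a‖ ^ 2 := by
      rw [WithLp.prod_norm_sq_eq_of_L2, @norm_add_sq ℂ, LinearIsometry.norm_map,
        ← inner_conj_symm, A.inner_idemIsometry _ (Subtype.prop (a.snd : annihilator A.mul))]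
      simp
    exact (sq_eq_sq₀ (norm_nonneg _) (norm_nonneg _)).1 h

theorem modelIsometry_idem (e : A.Idem) :
    A.modelIsometry (ModelSpace.idem A.idemWSet A.radHilb e) = e.1 := by
  let : DecidableEq A.idemWSet.carrier := fun e e' => Classical.propDecidable (e = e')
  have h1 : A.modelIsometry (ModelSpace.unitVec A.idemWSet A.radHilb e) =
      (A.idemWSet.root e)⁻¹ • e.1 := by
    change A.orthonormal_idem.orthogonalFamily.linearIsometry (lp.single 2 e 1) + 0 = _
    rw [OrthogonalFamily.linearIsometry_apply_single, add_zero]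
    exact one_smul ℂ ((A.idemWSet.root e)⁻¹ • e.1)
  rw [ModelSpace.idem, map_smul, h1, smul_inv_smul₀ (A.idemWSet.root_ne_zero e)]

theorem modelIsometry_inr (n : annihilator A.mul) :
    A.modelIsometry (ModelSpace.inr A.idemWSet A.radHilb n) = n.1 := by
  change A.idemIsometry 0 + n.1 = n.1
  rw [map_zero, zero_add]

/-- Elements are separated by the minimal idempotents and the annihilator. -/
theorem ext_inner {x y : A.toHilb} (h : ∀ e, IsMinIdempotent A.mul e → inner ℂ e x = inner ℂ e y)
    (h' : ∀ n ∈ annihilator A.mul, inner ℂ n x = inner ℂ n y) : x = y := by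
  have hmem : x - y ∈ annihilator A.mul :=
    mem_annihilator_of_forall_inner_eq_zero A.isCommSemigroup A.isFrobenius fun e he => by
      rw [inner_sub_right, h e he, sub_self]
  have := h' _ hmem
  rw [← sub_eq_zero, ← inner_sub_right] at this
  exact sub_eq_zero.1 (inner_self_eq_zero.1 this)

theorem inner_modelIsometry_idem (e : A.Idem) (a : ModelSpace A.idemWSet A.radHilb) :
    inner ℂ e.1 (A.modelIsometry a) = (‖e.1‖ : ℂ) ^ 2 * ModelSpace.ev (X := A.idemWSet) e a := by
  conv_lhs => rw [← A.modelIsometry_idem e]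
  rw [LinearIsometry.inner_map_map, ModelSpace.inner_idem]
  congr 1
  exact Complex.ofReal_pow _ _

theorem inner_modelIsometry_inr (n : annihilator A.mul) (a : ModelSpace A.idemWSet A.radHilb) :
    inner ℂ n.1 (A.modelIsometry a) = inner ℂ n (a.snd : annihilator A.mul) := by
  conv_lhs => rw [← A.modelIsometry_inr n]
  rw [LinearIsometry.inner_map_map]
  exact ModelSpace.inner_inr (X := A.idemWSet) (V := A.radHilb) n a

theorem inner_mul_of_mem_annihilator {n : A.toHilb} (hn : n ∈ annihilator A.mul) (x y : A.toHilb) :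
    inner ℂ n (A.mul (.tmul x y)) = 0 := by
  have : bil A.mul x n = 0 := by
    rw [A.isCommSemigroup.bil_comm, mem_annihilator.1 hn]
  rw [← bil_apply, ← ContinuousLinearMap.adjoint_inner_left,
    (adjoint_bil_eq_zero_iff A.isCommSemigroup A.isFrobenius).2 this, inner_zero_left]

theorem modelIsometry_mul (a b : ModelSpace A.idemWSet A.radHilb) :
    A.modelIsometry (ModelSpace.mul A.idemWSet A.radHilb (.tmul a b)) =
      A.mul (.tmul (A.modelIsometry a) (A.modelIsometry b)) := by
  refine A.ext_inner (fun e he => ?_) fun n hn => ?_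
  · have h0 := he.norm_sq_ne_zero
    rw [A.inner_modelIsometry_idem ⟨e, he⟩, ← bil_apply A.mul,
      he.inner_bil A.isCommSemigroup A.isFrobenius, A.inner_modelIsometry_idem ⟨e, he⟩,
      A.inner_modelIsometry_idem ⟨e, he⟩, ModelSpace.ev_mul]
    field_simp
  · rw [A.inner_mul_of_mem_annihilator hn, A.inner_modelIsometry_inr ⟨n, hn⟩, ModelSpace.mul_snd]
    exact inner_zero_right _

theorem modelIsometry_surjective : Function.Surjective A.modelIsometry := by
  rw [← LinearIsometry.coe_toLinearMap, ← LinearMap.range_eq_top]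
  have : CompleteSpace (LinearMap.range A.modelIsometry.toLinearMap) :=
    (A.modelIsometry.isometry.isUniformInducing.isComplete_range).completeSpace_coe
  refine (Submodule.orthogonal_eq_bot_iff).1 (eq_bot_iff.2 fun z hz => ?_)
  rw [Submodule.mem_orthogonal] at hz
  refine A.ext_inner (fun e he => ?_) fun n hn => ?_
  · rw [inner_zero_right]
    exact hz _ ⟨_, A.modelIsometry_idem ⟨e, he⟩⟩
  · rw [inner_zero_right]
    exact hz _ ⟨_, A.modelIsometry_inr ⟨n, hn⟩⟩

/-- Every commutative Hilbertian Frobenius semigroup is isomorphic to its model. -/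
def modelIso : model A.idemWSet A.radHilb ≅ A :=
  FrobSem.isoOfMul (A := model A.idemWSet A.radHilb)
    (LinearIsometryEquiv.ofSurjective A.modelIsometry
      A.modelIsometry_surjective).toContinuousLinearEquiv A.modelIsometry_mul

end FrobSem

instance : modelFunctor.{u}.EssSurj where
  mem_essImage A := ⟨(Opposite.op A.idemWSet, A.radHilb), ⟨A.modelIso⟩⟩

instance : modelFunctor.{u}.IsEquivalence where

/-! ### Finite-dimensional semigroups -/

theorem FrobSem.mul_idem_sum (A : FrobSem.{u}) (h : A.IsSemisimple) [Fintype A.Idem] (b : A.toHilb) :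
    bil A.mul (∑ e : A.Idem, e.1) b = b := by
  have hann : annihilator A.mul = ⊥ := by
    rw [← jacobsonRadical_eq_annihilator A.isCommSemigroup A.isFrobenius]
    exact h
  refine A.ext_inner (fun e he => ?_) fun n hn => ?_
  · have h1 : inner ℂ e (∑ e' : A.Idem, e'.1) = (‖e‖ : ℂ) ^ 2 := by
      rw [inner_sum, Finset.sum_eq_single ⟨e, he⟩]
      · exact inner_self_eq_norm_sq_to_K e
      · intro e' _ hne
        exact he.inner_eq_zero A.isCommSemigroup A.isFrobenius e'.2
          fun h => hne (Subtype.ext h.symm)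
      · exact fun h => absurd (Finset.mem_univ _) h
    rw [he.inner_bil A.isCommSemigroup A.isFrobenius, h1, mul_div_cancel_left₀ _ he.norm_sq_ne_zero]
  · rw [hann, Submodule.mem_bot] at hn
    rw [hn, inner_zero_left, inner_zero_left]

theorem FrobSem.finite_idem (A : FrobSem.{u}) [FiniteDimensional ℂ A.toHilb] : Finite A.Idem :=
  A.orthonormal_idem.linearIndependent.finite

/-- The unit of a finite-dimensional semisimple semigroup. -/
theorem FrobSem.exists_unit (A : FrobSem.{u}) (h : isSemisimpleFd A) :
    ∃ u : A.toHilb, ∀ b, bil A.mul u b = b := by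
  have := h.2
  have := A.finite_idem
  have := Fintype.ofFinite A.Idem
  exact ⟨_, A.mul_idem_sum h.1⟩

namespace FdFrobMon

theorem one_mul (A : FdFrobMon.{u}) (b : A.toHilb) : bil A.mul (A.unit 1) b = b := by
  have := congrArg (fun f => f (HTensor.tmul 1 b)) A.unit_mul
  simpa [HTensor.map_tmul, HTensor.lid_tmul, bil_apply] using this

theorem isSemisimpleFd (A : FdFrobMon.{u}) : isSemisimpleFd A.toFrobSem := by
  refine ⟨?_, A.finiteDimensional⟩
  rw [FrobSem.IsSemisimple, jacobsonRadical_eq_annihilator A.isCommSemigroup A.isFrobenius,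
    eq_bot_iff]
  intro x hx
  rw [Submodule.mem_bot, ← A.one_mul x, A.isCommSemigroup.bil_comm, mem_annihilator.1 hx]

theorem isProper {A B : FdFrobMon.{u}} (f : A ⟶ B) : IsProper B.mul f.toCLM := by
  intro I hI hle
  have h1 : B.unit 1 ∈ I := by
    rw [← f.map_unit]
    exact hle ⟨A.unit 1, rfl⟩
  refine hI.ne_top (eq_top_iff.2 fun b _ => ?_)
  rw [← B.one_mul b]
  exact (hI.isIdeal b _ h1).2

/-- A proper semigroup morphism between monoids preserves the unit. -/
theorem map_unit_of_isProper {A B : FdFrobMon.{u}} {f : A.toHilb →L[ℂ] B.toHilb}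
    (hf : IsSemigroupMap A.mul B.mul f) (hp : IsProper B.mul f) : f ∘L A.unit = B.unit := by
  refine ContinuousLinearMap.ext_ring ?_
  have hann : annihilator B.mul = ⊥ := by
    rw [← jacobsonRadical_eq_annihilator B.isCommSemigroup B.isFrobenius]
    exact B.isSemisimpleFd.1
  refine B.ext_inner (fun e he => ?_) fun n hn => ?_
  · have h0 := he.norm_sq_ne_zero
    obtain ⟨a, ha⟩ : ∃ a, inner ℂ e (f a) ≠ 0 := by
      by_contra! h
      refine hp _ (he.isMaximalModularIdeal B.isCommSemigroup B.isFrobenius) ?_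
      rintro _ ⟨a, rfl⟩
      exact h a
    have key : ∀ x : B.toHilb, (∃ b, inner ℂ e b ≠ 0 ∧ bil B.mul x b = b) →
        inner ℂ e x = (‖e‖ : ℂ) ^ 2 := by
      rintro x ⟨b, hb, hxb⟩
      have := he.inner_bil B.isCommSemigroup B.isFrobenius x b
      rw [hxb, eq_div_iff h0] at this
      exact (mul_right_cancel₀ hb ((mul_comm _ _).trans this)).symm
    rw [key _ ⟨f a, ha, B.one_mul _⟩]
    refine key _ ⟨f a, ha, ?_⟩
    have := hf.apply (A.unit 1) a
    rw [← bil_apply, A.one_mul] at this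
    exact this.symm
  · rw [hann, Submodule.mem_bot] at hn
    rw [hn, inner_zero_left, inner_zero_left]

/-- The functor forgetting the unit. -/
def forgetUnit : FdFrobMon.{u} ⥤ SemisimpleFdFrobSem.{u} where
  obj A := ⟨A.toFrobSem, A.isSemisimpleFd⟩
  map {A B} f := ObjectProperty.homMk (⟨f.toCLM, f.isSemigroupMap, isProper f⟩ :
    FrobSem.ProperHom A.toFrobSem B.toFrobSem)

instance : forgetUnit.{u}.Faithful where
  map_injective h := FdFrobMon.Hom.ext
    (congrArg (fun k => FrobSem.ProperHom.toCLM (InducedCategory.Hom.hom k)) h)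

instance : forgetUnit.{u}.Full where
  map_surjective f := ⟨⟨f.hom.toCLM, f.hom.isSemigroupMap,
    map_unit_of_isProper f.hom.isSemigroupMap f.hom.isProper⟩, rfl⟩

/-- The monoid structure of a Frobenius semigroup with a unit element. -/
def ofUnit (A : FrobSem.{u}) (h : FiniteDimensional ℂ A.toHilb) (e : A.toHilb)
    (he : ∀ b, bil A.mul e b = b) : FdFrobMon.{u} where
  toFrobSem := A
  unit := ContinuousLinearMap.toSpanSingleton ℂ e
  finiteDimensional := h
  unit_mul := HTensor.clm_ext fun c x => by
    have : A.mul (.tmul (c • e) x) = c • x := by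
      rw [← bil_apply, map_smul, smul_apply, he]
    simpa [HTensor.map_tmul, HTensor.lid_tmul] using this
  mul_unit := HTensor.clm_ext fun x c => by
    have : A.mul (.tmul x (c • e)) = c • x := by
      rw [← bil_apply, map_smul, A.isCommSemigroup.bil_comm, he]
    simpa [HTensor.map_tmul, HTensor.rid, HTensor.comm_tmul, HTensor.lid_tmul] using this

instance : forgetUnit.{u}.EssSurj where
  mem_essImage A := by
    obtain ⟨e, he⟩ := A.obj.exists_unit A.property
    exact ⟨ofUnit A.obj A.property.2 e he, ⟨Iso.refl _⟩⟩

instance : forgetUnit.{u}.IsEquivalence where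

end FdFrobMon

/-! ### Finite sets -/

/-- A finite set with constant weight `1`. -/
abbrev WSet.ofFinite (X : Type u) : WSet.{u} where
  carrier := X
  weight _ := 1
  weight_bound := ⟨1, one_pos, fun _ => le_rfl⟩

/-- Every map out of a finite set is a morphism of weighted sets. -/
def WSet.Hom.ofFinite {X Y : WSet.{u}} [Finite X.carrier] (f : X.carrier → Y.carrier) :
    WSet.Hom X Y where
  toFun := f
  finite_fiber y := Set.toFinite _
  weight_le := by
    have := Fintype.ofFinite X.carrier
    obtain ⟨C, hC, h⟩ := Y.weight_bound
    have hsum : 0 ≤ ∑ x, X.weight x := Finset.sum_nonneg fun x _ => (X.weight_pos x).le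
    refine ⟨(∑ x, X.weight x) / C, by positivity, fun y => ?_⟩
    calc ∑ x ∈ (Set.toFinite (f ⁻¹' {y})).toFinset, X.weight x ≤ ∑ x, X.weight x :=
          Finset.sum_le_sum_of_subset_of_nonneg (Finset.subset_univ _) fun x _ _ =>
            (X.weight_pos x).le
      _ = (∑ x, X.weight x) / C * C := (div_mul_cancel₀ _ hC.ne').symm
      _ ≤ (∑ x, X.weight x) / C * Y.weight y := by gcongr; exact h y

/-- Weighted sets with finite underlying sets in bijection are isomorphic. -/
def WSet.isoOfFinite {X Y : WSet.{u}} [Finite X.carrier] [Finite Y.carrier]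
    (e : X.carrier ≃ Y.carrier) : X ≅ Y where
  hom := WSet.Hom.ofFinite e
  inv := WSet.Hom.ofFinite e.symm
  hom_inv_id := WSet.Hom.ext (funext e.symm_apply_apply)
  inv_hom_id := WSet.Hom.ext (funext e.apply_symm_apply)

/-- The zero Hilbert space. -/
abbrev Hilb.zero : Hilb.{u} where
  carrier := PUnit.{u + 1}

/-- Hilbert spaces with at most one element are isomorphic. -/
def Hilb.isoOfSubsingleton (V W : Hilb.{u}) [Subsingleton V] [Subsingleton W] : V ≅ W where
  hom := (0 : V →L[ℂ] W)
  inv := (0 : W →L[ℂ] V)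
  hom_inv_id := ContinuousLinearMap.ext fun _ => Subsingleton.elim _ _
  inv_hom_id := ContinuousLinearMap.ext fun _ => Subsingleton.elim _ _

/-- Finite sets as pairs of a weighted set and the zero Hilbert space. -/
def finSetToPair : FintypeCat.{u}ᵒᵖ ⥤ WSet.{u}ᵒᵖ × Hilb.{u} where
  obj X := (op (WSet.ofFinite X.unop.obj), Hilb.zero)
  map {X Y} f :=
    have : Finite (WSet.ofFinite Y.unop.obj).carrier := Y.unop.property
    (Quiver.Hom.op (V := WSet.{u}) (X := WSet.ofFinite Y.unop.obj) (Y := WSet.ofFinite X.unop.obj)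
      (WSet.Hom.ofFinite fun y => f.unop y), 𝟙 _)

instance : finSetToPair.{u}.Faithful where
  map_injective h := Quiver.Hom.unop_inj (FintypeCat.hom_ext _ _ fun y =>
    congrFun (congrArg (fun k => WSet.Hom.toFun (Quiver.Hom.unop (Prod.fst k))) h) y)

instance : finSetToPair.{u}.Full where
  map_surjective {X Y} f := by
    refine ⟨Quiver.Hom.op (FintypeCat.homMk fun y => f.1.unop.toFun y), Prod.ext rfl ?_⟩
    exact ContinuousLinearMap.ext fun _ => Subsingleton.elim (α := PUnit) _ _

theorem ModelSpace.ev_eq_zero_of_mem_jacobsonRadical {X : WSet.{u}} {V : Hilb.{u}}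
    {a : ModelSpace X V} (ha : a ∈ jacobsonRadical (ModelSpace.mul X V)) (x : X.carrier) :
    ModelSpace.ev x a = 0 := by
  rw [jacobsonRadical, Submodule.mem_sInf] at ha
  exact LinearMap.mem_ker.1 (ha _ (ModelSpace.isMaximalModularIdeal_ker_ev x))

theorem model_isSemisimpleFd (X : Type u) [Finite X] :
    isSemisimpleFd (model (WSet.ofFinite X) Hilb.zero) := by
  have hext : ∀ a b : ModelSpace (WSet.ofFinite X) Hilb.zero,
      (∀ x : X, ModelSpace.ev (X := WSet.ofFinite X) x a = ModelSpace.ev x b) → a = b :=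
    fun a b h => ModelSpace.ext h (Subsingleton.elim (α := PUnit) _ _)
  constructor
  · have h : jacobsonRadical (ModelSpace.mul (WSet.ofFinite X) Hilb.zero) = ⊥ :=
      eq_bot_iff.2 fun a ha => hext a 0 fun x => by
        rw [map_zero, ModelSpace.ev_eq_zero_of_mem_jacobsonRadical ha]
    exact h
  · let L : ModelSpace (WSet.ofFinite X) Hilb.zero →ₗ[ℂ] X → ℂ :=
      LinearMap.pi fun x => (ModelSpace.ev (X := WSet.ofFinite X) x).toLinearMap
    have hL : Function.Injective L := fun a b h => hext a b fun x => congrFun h x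
    have h : FiniteDimensional ℂ (ModelSpace (WSet.ofFinite X) Hilb.zero) :=
      FiniteDimensional.of_injective L hL
    exact h

/-- The functor sending a finite set to the semisimple semigroup of functions on it. -/
def finSetModel : FintypeCat.{u}ᵒᵖ ⥤ SemisimpleFdFrobSem.{u} :=
  isSemisimpleFd.lift (finSetToPair ⋙ modelFunctor) fun X =>
    have : Finite X.unop.obj := X.unop.property
    model_isSemisimpleFd X.unop.obj

instance : (finSetToPair.{u} ⋙ modelFunctor.{u}).Faithful :=
  Functor.Faithful.comp _ _

instance : (finSetToPair.{u} ⋙ modelFunctor.{u}).Full :=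
  Functor.Full.comp _ _

instance : finSetModel.{u}.Faithful :=
  Functor.Faithful.of_comp_iso (ObjectProperty.liftCompιIso _ (finSetToPair ⋙ modelFunctor) _)

instance : finSetModel.{u}.Full :=
  Functor.Full.of_comp_faithful_iso
    (ObjectProperty.liftCompιIso _ (finSetToPair ⋙ modelFunctor) _)

instance : finSetModel.{u}.EssSurj where
  mem_essImage A := by
    have := A.property.2
    have hfin := A.obj.finite_idem
    have hann : annihilator A.obj.mul = ⊥ := by
      rw [← jacobsonRadical_eq_annihilator A.obj.isCommSemigroup A.obj.isFrobenius]
      exact A.property.1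
    have hV : Subsingleton A.obj.radHilb := (Submodule.subsingleton_iff_eq_bot).2 hann
    have : Finite A.obj.idemWSet.carrier := hfin
    refine ⟨op (FintypeCat.of A.obj.Idem), ⟨isSemisimpleFd.isoMk (?_ ≪≫ A.obj.modelIso)⟩⟩
    have : Finite (WSet.ofFinite A.obj.Idem).carrier := hfin
    have : Subsingleton Hilb.zero.{u} := inferInstanceAs (Subsingleton PUnit)
    exact modelFunctor.mapIso (X := (op (WSet.ofFinite A.obj.Idem), Hilb.zero))
      (Y := (op A.obj.idemWSet, A.obj.radHilb)) (Iso.prod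
        (WSet.isoOfFinite (X := A.obj.idemWSet) (Y := WSet.ofFinite A.obj.Idem) (Equiv.refl _)).op
        (Hilb.isoOfSubsingleton _ _))

instance : finSetModel.{u}.IsEquivalence where

end

end HilbFrob

theorem mainTheorem11 :
    Nonempty (HilbFrob.FrobSem.{u} ≌ HilbFrob.WSet.{u}ᵒᵖ × HilbFrob.Hilb.{u}) ∧
    Nonempty (HilbFrob.SemisimpleFdFrobSem.{u} ≌ HilbFrob.FdFrobMon.{u}) ∧
    Nonempty (HilbFrob.FdFrobMon.{u} ≌ FintypeCat.{u}ᵒᵖ) :=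
  ⟨⟨HilbFrob.modelFunctor.asEquivalence.symm⟩,
    ⟨HilbFrob.FdFrobMon.forgetUnit.asEquivalence.symm⟩,
    ⟨HilbFrob.FdFrobMon.forgetUnit.asEquivalence.trans
      HilbFrob.finSetModel.asEquivalence.symm⟩⟩
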